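/- Consider a single-server first-come-first-served queue with Poisson arrivals of rate $\lambda>0$. The server works in a low mode $0$ with exponential service rate $\mu_0$ or in a high mode $1$ with rate $\mu_1$, where $0<\mu_0<\mu_1$ and $\lambda<\mu_1$. Inspections occur according to an independent Poisson stream of rate $\gamma\in(0,\infty)$; at an inspection the mode is set to high if more than $K$ customers are present and to low otherwise, where $K\ge 1$ is a fixed integer. For a tagged customer at position $n$ in the queue (position $1$ being in service) with $m$ customers behind him and the server in mode $i$, let $S_i(n,m)$ be his remaining sojourn time, with $S_i(0,m)=0$; it is almost surely finite. For $\operatorname{Re}s\ge 0$ let $\psi(n,m,s)$ be the row vector of the Laplace transforms $\psi_i(n,m,s)=\mathbb{E}[e^{-sS_i(n,m)}]$, $i=0,1$. For a complex $2\times2$ matrix $Z$ with all eigenvalues in the open unit disk put $$\phi(Z,m,s)=\sum_{h=0}^\infty \psi(K+h+1,m,s)\,Z^h .$$ Let $M=\operatorname{diag}(\mu_0,\mu_1)$, $\Lambda=\operatorname{diag}(\lambda,\lambda)$ and $H_3=M+\Lambda+\begin{pmatrix}\gamma&0\\-\gamma&0\end{pmatrix}$. Then the Markov chain (mode, number of customers)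 has a unique stationary distribution; write $\pi_n=(\pi_{0n},\pi_{1n})^\top$ for the column vector of the stationary probabilities of $n$ customers in mode $0$ and in mode $1$. The equation $\Lambda-H_3R+MR^2=0$ has a unique entrywise minimal nonnegative solution $R$; all eigenvalues of $R$ lie in the open unit disk, and $\pi_{K+h}=R^h\pi_K$ for all $h\ge 0$. There is a unique law $\alpha$ on the states of the chain such that, if a customer finds the queue in a state with law $\alpha$, then so does the next customer (the stationary regime at arrivals). Let $S^*$ be the stationary sojourn time, that is, the sojourn time of a customer who finds the queue in a state with law $\alpha$. Then $S^*$ is almost surely finite, and for all complex $s$ with $\operatorname{Re}s\ge0$ the series $\phi(R,0,s)$ converges and the Laplace transform $\psi(s)=\mathbb{E}[e^{-sS^*}]$ is given by $$\psi(s)=\sum_{n=0}^{K-1}\psi(n+1,0,s)\,\pi_n+\phi(R,0,s)\,\pi_K .$$ -/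

import Mathlib

open MeasureTheory ProbabilityTheory
open scoped ENNReal

namespace InspectionQueue

noncomputable section

/-- The parameters of the queue: threshold `K`, arrival rate `lam`, low and high service rates
`mu0`, `mu1`, and rate `gam` of the Poisson stream of inspections. -/
structure Params where
  K : ℕ
  lam : ℝ
  mu0 : ℝ
  mu1 : ℝ
  gam : ℝ

/-- Kinds of events: an arrival, a service completion, an inspection of the queue. -/
inductive Event where
  | arrival
  | service
  | inspection

/-- A state of the queue: the mode of the server (`0` low rate, `1` high rate) and the number of
customers in the system. -/
abbrev State : Type := Fin 2 × ℕ

/-- A state of the queue seen from a tagged customer: the mode of the server, the position `n` of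
the tagged customer (position `1` is in service, `n = 0` means that the tagged customer has left)
and the number `m` of customers behind the tagged one. There are `n + m` customers in the system. -/
abbrev TaggedState : Type := Fin 2 × ℕ × ℕ

namespace Params

variable (p : Params)

/-- The service rate in each of the two modes. -/
def mu : Fin 2 → ℝ := ![p.mu0, p.mu1]

/-- The rate at which each kind of event occurs; there are no services in an empty system. -/
def rate (x : State) : Event → ℝ
  | .arrival => p.lam
  | .service => if x.2 = 0 then 0 else p.mu x.1
  | .inspection => p.gam

/-- The total rate of events. -/
def totalRate (x : State) : ℝ :=
  p.rate x .arrival + p.rate x .service + p.rate x .inspection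

/-- The mode chosen at an inspection that finds `q` customers: high if and only if `q > K`. -/
def inspectedMode (q : ℕ) : Fin 2 := if p.K < q then 1 else 0

/-- The state of the queue after an event. -/
def next (x : State) : Event → State
  | .arrival => (x.1, x.2 + 1)
  | .service => (x.1, x.2 - 1)
  | .inspection => (p.inspectedMode x.2, x.2)

/-- The contribution of the events of kind `e` to the generator. -/
def generatorPart (e : Event) (x y : State) : ℝ :=
  p.rate x e * ((if p.next x e = y then 1 else 0) - (if x = y then 1 else 0))

/-- The generator of the Markov chain of the mode and the number of customers. -/
def generator (x y : State) : ℝ :=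
  p.generatorPart .arrival x y + p.generatorPart .service x y + p.generatorPart .inspection x y

/-- `π` is a stationary distribution of the Markov chain of the mode and the number of customers:
a probability vector that satisfies the global balance equations. -/
structure IsStationary (π : State → ℝ) : Prop where
  nonneg : ∀ x, 0 ≤ π x
  total : HasSum π 1
  balance : ∀ y, HasSum (fun x => π x * p.generator x y) 0

/-! ### The queue with a tagged customer, through its jump chain and holding times -/

/-- The state of the queue, forgetting who is the tagged customer. -/
def forget (x : TaggedState) : State := (x.1, x.2.1 + x.2.2)

/-- The tagged state after an event; customers are served in order of arrival, so that a service
completion is that of a customer ahead of the tagged one, or of the tagged one, as long as the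
tagged one is present. -/
def taggedNext (x : TaggedState) : Event → TaggedState
  | .arrival => (x.1, x.2.1, x.2.2 + 1)
  | .service => if x.2.1 = 0 then (x.1, 0, x.2.2 - 1) else (x.1, x.2.1 - 1, x.2.2)
  | .inspection => (p.inspectedMode (x.2.1 + x.2.2), x.2.1, x.2.2)

/-- The driving randomness: for each event a pair of numbers, the first one for the time until the
event, the second one for its kind. -/
abbrev Noise : Type := ℕ → ℝ × unitInterval

instance : IsProbabilityMeasure (expMeasure 1) := isProbabilityMeasure_expMeasure one_pos

/-- The pairs are independent; in each pair the first number is exponential with rate `1`, the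
second one is uniform on the unit interval, and the two are independent. -/
def noiseLaw : Measure Noise :=
  Measure.infinitePi fun _ : ℕ => (expMeasure 1).prod (volume : Measure unitInterval)

/-- The kind of the next event: if `u` is uniform on the unit interval, then each event `e` is
chosen with probability `rate x e / totalRate x`. -/
def chooseEvent (x : State) (u : unitInterval) : Event :=
  if (u : ℝ) * p.totalRate x < p.lam then .arrival
  else if (u : ℝ) * p.totalRate x < p.lam + p.gam then .inspection
  else .service

/-- The tagged state after the first `k` events, when it is `x` at time `0`. -/
def path (x : TaggedState) (ω : Noise) : ℕ → TaggedState
  | 0 => x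
  | k + 1 => p.taggedNext (path x ω k) (p.chooseEvent (forget (path x ω k)) (ω k).2)

/-- The kind of the event number `k` (the first one has number `0`). -/
def eventAt (x : TaggedState) (ω : Noise) (k : ℕ) : Event :=
  p.chooseEvent (forget (p.path x ω k)) (ω k).2

/-- The time spent between the event before event number `k` (or time `0`, if `k = 0`) and event
number `k`: it is exponential with rate `totalRate` of the current state. -/
def holdingTime (x : TaggedState) (ω : Noise) (k : ℕ) : ℝ :=
  (ω k).1 / p.totalRate (forget (p.path x ω k))

/-- The sojourn time `S_i(n, m)` of the tagged customer, for `x = (i, n, m)`: the total time that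
the customer still spends in the system. -/
def sojourn (x : TaggedState) (ω : Noise) : ℝ≥0∞ :=
  ∑' k : ℕ, if (p.path x ω k).2.1 = 0 then 0 else ENNReal.ofReal (p.holdingTime x ω k)

/-- The tagged state just after the arrival of the tagged customer, who finds the queue in
state `x`. -/
def enter (x : State) : TaggedState := (x.1, x.2 + 1, 0)

/-- The number of the first arrival after time `0`. -/
def firstArrival (x : TaggedState) (ω : Noise) : ℕ := sInf {k | p.eventAt x ω k = .arrival}

/-- The state of the queue found by the first customer who arrives after time `0`. -/
def foundByNext (x : TaggedState) (ω : Noise) : State :=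
  forget (p.path x ω (p.firstArrival x ω))

/-- The queue is in stationary regime at arrivals: when a customer finds the queue in a state with
law `α`, then so does the next customer. -/
structure IsArrivalStationary (α : Measure State) : Prop where
  isProbabilityMeasure : IsProbabilityMeasure α
  invariant :
    (α.prod noiseLaw).map (fun z : State × Noise => p.foundByNext (enter z.1) z.2) = α

/-- The stationary sojourn time `S*`: the sojourn time of a customer who arrives at a queue in
stationary regime. The probability space is `α.prod noiseLaw`, where `α` is the law of the state
found by the customers. -/
def stationarySojourn (z : State × Noise) : ℝ≥0∞ := p.sojourn (enter z.1) z.2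

/-! ### Laplace transforms -/

/-- The Laplace transform `E[exp(-s T)]` of an almost surely finite random time `T`. -/
def laplace {Ω : Type*} [MeasurableSpace Ω] (P : Measure Ω) (T : Ω → ℝ≥0∞) (s : ℂ) : ℂ :=
  ∫ ω, Complex.exp (-s * ((T ω).toReal : ℂ)) ∂P

/-- The row vector `ψ(n, m, s)` of the Laplace transforms of `S_0(n, m)` and `S_1(n, m)`. -/
def psi (n m : ℕ) (s : ℂ) : Fin 2 → ℂ := fun i => laplace noiseLaw (p.sojourn (i, n, m)) s

/-- The terms of the series `∑ h, ψ(K + h + 1, m, s) Z ^ h`. -/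
def phiTerm (Z : Matrix (Fin 2) (Fin 2) ℂ) (m : ℕ) (s : ℂ) (h : ℕ) : Fin 2 → ℂ :=
  Matrix.vecMul (p.psi (p.K + h + 1) m s) (Z ^ h)

/-- The matrix generating function `φ(Z, m, s) = ∑ h, ψ(K + h + 1, m, s) Z ^ h`. -/
def phi (Z : Matrix (Fin 2) (Fin 2) ℂ) (m : ℕ) (s : ℂ) : Fin 2 → ℂ :=
  ∑' h : ℕ, p.phiTerm Z m s h

/-! ### The matrix equation -/

/-- The matrix `M = diag(μ₀, μ₁)`. -/
def matM : Matrix (Fin 2) (Fin 2) ℝ := !![p.mu0, 0; 0, p.mu1]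

/-- The matrix `Λ = diag(λ, λ)`. -/
def matLam : Matrix (Fin 2) (Fin 2) ℝ := !![p.lam, 0; 0, p.lam]

/-- The matrix `Γ₃`. -/
def matGam3 : Matrix (Fin 2) (Fin 2) ℝ := !![p.gam, 0; -p.gam, 0]

/-- The matrix `H₃ = M + Λ + Γ₃`. -/
def matH3 : Matrix (Fin 2) (Fin 2) ℝ := p.matM + p.matLam + p.matGam3

/-- `R` is an entrywise nonnegative solution of `Λ - H₃ R + M R ^ 2 = 0`. -/
def IsNonnegSolution (R : Matrix (Fin 2) (Fin 2) ℝ) : Prop :=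
  (∀ i j, 0 ≤ R i j) ∧ p.matLam - p.matH3 * R + p.matM * R ^ 2 = 0

/-- `R` is the minimal nonnegative solution, for the entrywise order. -/
def IsMinimalSolution (R : Matrix (Fin 2) (Fin 2) ℝ) : Prop :=
  p.IsNonnegSolution R ∧ ∀ X, p.IsNonnegSolution X → ∀ i j, R i j ≤ X i j

/-- The column vector `π_n = (π_{0n}, π_{1n})`. -/
def level (π : State → ℝ) (n : ℕ) : Fin 2 → ℝ := fun i => π (i, n)

/-- A real vector as a complex vector. -/
def toComplex (v : Fin 2 → ℝ) : Fin 2 → ℂ := fun i => (v i : ℂ)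

end Params

end

end InspectionQueue

namespace InspectionQueue

namespace Params

/-! A customer who finds the state `(i, n)` enters at position `n + 1` with nobody behind, so
conditioning on the state found gives `ψ(s) = ∑ n, ψ(n + 1, 0, s) α_n`. Two facts turn this into the
formula: the law `α` seen by arrivals is the stationary law `π`, and `π_{K+h} = R ^ h π_K`, so that
the terms from level `K` on add up to `φ(R, 0, s) π_K`.

The matrix `R` is explicit. Above the threshold an inspection can only switch low to high, so `R` is
lower triangular: its diagonal consists of the small root of a scalar quadratic and of `λ / μ₁`,
both below one (`isMinimalSolution_rateMatrix`).

For `π`, global balance is equivalent to balance across the cuts between levels together with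
balance of the high states (`balance_iff`). Above level `K` the low mode then satisfies a scalar
recurrence, and summability excludes its growing root (`IsBalanced.low_tail`); the cut equation
gives the high mode. A summable solution is determined by its value at `(1, 0)`
(`IsBalanced.eq_zero`), and a positive one is built by recursion from the empty system
(`isBalanced_weight`).

To identify `α` with `π`, follow the queue from one arrival to the next. The next customer finds `y`
with probability equal to the expected number of visits to `y` in between, times `λ / totalRate y`.
These expected numbers are the minimal nonnegative solution of a first-step equation, and that
equation, for `α` scaled by `totalRate / λ`, is global balance (`tsum_inflow_eq`). Hence
stationarity at arrivals and stationarity in time are the same condition. -/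

/-- The conditions on the parameters under which the queue is stable. -/
structure Stable (p : Params) : Prop where
  lam_pos : 0 < p.lam
  mu0_pos : 0 < p.mu0
  mu0_lt_mu1 : p.mu0 < p.mu1
  gam_pos : 0 < p.gam
  lam_lt_mu1 : p.lam < p.mu1

variable {p : Params}

theorem Stable.mu1_pos (hp : p.Stable) : 0 < p.mu1 := hp.mu0_pos.trans hp.mu0_lt_mu1

/-! ### The minimal solution of the matrix equation -/

/-- The root in `(0, 1)` of `λ - (μ₀ + λ + γ) a + μ₀ a ^ 2`. -/
noncomputable def lowDecay (p : Params) : ℝ :=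
  ((p.mu0 + p.lam + p.gam) - √((p.mu0 + p.lam + p.gam) ^ 2 - 4 * p.lam * p.mu0)) / (2 * p.mu0)

/-- The decay rate of the high mode above the threshold. -/
noncomputable def highDecay (p : Params) : ℝ := p.lam / p.mu1

/-- The off-diagonal entry of the rate matrix. -/
noncomputable def mixing (p : Params) : ℝ := p.gam * p.lowDecay / (p.mu1 * (1 - p.lowDecay))

theorem lowDecay_eq (hp : p.Stable) :
    p.lam - (p.mu0 + p.lam + p.gam) * p.lowDecay + p.mu0 * p.lowDecay ^ 2 = 0 := by
  obtain ⟨hl, h0, -, hg, -⟩ := hp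
  have hs : √((p.mu0 + p.lam + p.gam) ^ 2 - 4 * p.lam * p.mu0) ^ 2 =
      (p.mu0 + p.lam + p.gam) ^ 2 - 4 * p.lam * p.mu0 :=
    Real.sq_sqrt (by nlinarith [sq_nonneg (p.mu0 - p.lam), mul_pos hl hg, mul_pos h0 hg])
  rw [lowDecay]
  generalize √((p.mu0 + p.lam + p.gam) ^ 2 - 4 * p.lam * p.mu0) = r at hs ⊢
  field_simp
  linear_combination hs

theorem lowDecay_pos (hp : p.Stable) : 0 < p.lowDecay := by
  obtain ⟨hl, h0, -, hg, -⟩ := hp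
  refine div_pos (sub_pos.2 ?_) (by positivity)
  rw [Real.sqrt_lt' (by positivity)]
  nlinarith [mul_pos hl h0]

theorem lowDecay_lt_one (hp : p.Stable) : p.lowDecay < 1 := by
  obtain ⟨hl, h0, -, hg, -⟩ := hp
  rw [lowDecay, div_lt_one (by positivity)]
  -- The two squares differ by `4 γ μ₀`.
  have : p.lam + p.gam - p.mu0 < √((p.mu0 + p.lam + p.gam) ^ 2 - 4 * p.lam * p.mu0) :=
    Real.lt_sqrt_of_sq_lt (by nlinarith [mul_pos hg h0])
  linarith

/-- With `a = lowDecay`, the quadratic factors as `(λ - μ₀ a) (1 - a) = γ a > 0`. Equivalently, the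
other root `λ / (μ₀ a)` exceeds one. -/
theorem mu0_mul_lowDecay_lt (hp : p.Stable) : p.mu0 * p.lowDecay < p.lam := by
  have h1 : (p.lam - p.mu0 * p.lowDecay) * (1 - p.lowDecay) = p.gam * p.lowDecay := by
    linear_combination lowDecay_eq hp
  have h2 := mul_pos hp.gam_pos (lowDecay_pos hp)
  rw [← h1] at h2
  exact sub_pos.1 (pos_of_mul_pos_left h2 (sub_pos.2 (lowDecay_lt_one hp)).le)

theorem highDecay_pos (hp : p.Stable) : 0 < p.highDecay := div_pos hp.lam_pos hp.mu1_pos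

theorem highDecay_lt_one (hp : p.Stable) : p.highDecay < 1 :=
  (div_lt_one hp.mu1_pos).2 hp.lam_lt_mu1

theorem mu1_mul_highDecay (hp : p.Stable) : p.mu1 * p.highDecay = p.lam :=
  mul_div_cancel₀ _ hp.mu1_pos.ne'

theorem mixing_pos (hp : p.Stable) : 0 < p.mixing :=
  div_pos (mul_pos hp.gam_pos (lowDecay_pos hp))
    (mul_pos hp.mu1_pos (sub_pos.2 (lowDecay_lt_one hp)))

theorem mixing_eq (hp : p.Stable) :
    p.mixing * (p.mu1 * (1 - p.lowDecay)) = p.gam * p.lowDecay :=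
  div_mul_cancel₀ _ (mul_pos hp.mu1_pos (sub_pos.2 (lowDecay_lt_one hp))).ne'

/-- The minimal nonnegative solution of the matrix equation. -/
noncomputable def rateMatrix (p : Params) : Matrix (Fin 2) (Fin 2) ℝ :=
  !![p.lowDecay, 0; p.mixing, p.highDecay]

theorem isNonnegSolution_iff (X : Matrix (Fin 2) (Fin 2) ℝ) :
    p.IsNonnegSolution X ↔ (∀ i j, 0 ≤ X i j) ∧
      p.lam - (p.mu0 + p.lam + p.gam) * X 0 0 +
        p.mu0 * (X 0 0 * X 0 0 + X 0 1 * X 1 0) = 0 ∧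
      -(p.mu0 + p.lam + p.gam) * X 0 1 + p.mu0 * (X 0 0 * X 0 1 + X 0 1 * X 1 1) = 0 ∧
      p.gam * X 0 0 - (p.mu1 + p.lam) * X 1 0 +
        p.mu1 * (X 1 0 * X 0 0 + X 1 1 * X 1 0) = 0 ∧
      p.lam + p.gam * X 0 1 - (p.mu1 + p.lam) * X 1 1 +
        p.mu1 * (X 1 0 * X 0 1 + X 1 1 * X 1 1) = 0 := by
  unfold IsNonnegSolution
  refine and_congr_right fun _ => ?_
  rw [← Matrix.ext_iff]
  simp only [Fin.forall_fin_two, matLam, matH3, matM, matGam3, pow_two, Matrix.mul_apply,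
    Fin.sum_univ_two, Matrix.add_apply, Matrix.sub_apply, Matrix.of_apply, Matrix.cons_val',
    Matrix.cons_val_zero, Matrix.cons_val_one, Matrix.cons_val_fin_one, Matrix.zero_apply]
  constructor
  · rintro ⟨⟨h1, h2⟩, h3, h4⟩
    refine ⟨?_, ?_, ?_, ?_⟩ <;> linarith
  · rintro ⟨h1, h2, h3, h4⟩
    refine ⟨⟨?_, ?_⟩, ?_, ?_⟩ <;> linarith

/-- For a nonnegative solution `X`, dropping the nonnegative off-diagonal terms from the diagonal
equations leaves scalar quadratics that are at most zero at `X 0 0` and `X 1 1`, so these entries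
are at least the smaller roots. The equation for `X 1 0` is then monotone in the two diagonal
entries and bounds `X 1 0` from below. -/
theorem isMinimalSolution_rateMatrix (hp : p.Stable) : p.IsMinimalSolution p.rateMatrix := by
  have ha := lowDecay_pos hp
  have ha1 := lowDecay_lt_one hp
  have hc1 := highDecay_lt_one hp
  have hb := mixing_pos hp
  have hq := lowDecay_eq hp
  have hc := mu1_mul_highDecay hp
  have hm := mixing_eq hp
  have hc0 := highDecay_pos hp
  have hlt := mu0_mul_lowDecay_lt hp
  obtain ⟨hl, h0, h01, hg, hl1⟩ := hp
  constructor
  · rw [isNonnegSolution_iff]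
    simp only [Fin.forall_fin_two, rateMatrix, Matrix.of_apply, Matrix.cons_val',
      Matrix.cons_val_zero, Matrix.cons_val_one, Matrix.cons_val_fin_one]
    refine ⟨⟨⟨ha.le, le_rfl⟩, hb.le, hc0.le⟩, by linarith, by ring, ?_, ?_⟩
    · linear_combination -hm + p.mixing * hc
    · linear_combination (p.highDecay - 1) * hc
  · intro X hX
    rw [isNonnegSolution_iff] at hX
    obtain ⟨hX, e00, -, e10, e11⟩ := hX
    have x00 := hX 0 0
    have x01 := hX 0 1
    have x10 := hX 1 0
    have x11 := hX 1 1
    have hyz := mul_nonneg x01 x10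
    have k00 : p.lowDecay ≤ X 0 0 := by
      by_contra! hlt
      -- The product is the value of the quadratic at `X 0 0`, since the value at `lowDecay` is
      -- zero; positivity contradicts `e00`.
      have hprod : 0 < (p.lowDecay - X 0 0) *
          ((p.mu0 + p.lam + p.gam) - p.mu0 * (p.lowDecay + X 0 0)) := by
        refine mul_pos (sub_pos.2 hlt) ?_
        -- By the quadratic, the right side equals `λ - μ₀ * lowDecay`.
        have h1 : 0 < ((p.mu0 + p.lam + p.gam) - p.mu0 * p.lowDecay - p.mu0) * p.lowDecay := by
          linarith
        have h2 := pos_of_mul_pos_left h1 ha.le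
        nlinarith
      nlinarith [mul_nonneg h0.le hyz]
    have k11 : p.highDecay ≤ X 1 1 := by
      by_contra! hlt
      have hprod : 0 < (p.highDecay - X 1 1) * (p.mu1 * (1 - X 1 1)) :=
        mul_pos (sub_pos.2 hlt) (mul_pos (h0.trans h01) (by linarith))
      nlinarith [mul_nonneg (h0.trans h01).le hyz, mul_nonneg hg.le x01]
    have k10 : p.mixing ≤ X 1 0 := by
      have hpos : 0 < p.mu1 * (1 - p.lowDecay) :=
        mul_pos (h0.trans h01) (sub_pos.2 ha1)
      refine le_of_mul_le_mul_right ?_ hpos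
      rw [hm]
      have h1 : p.gam * p.lowDecay ≤ p.gam * X 0 0 := mul_le_mul_of_nonneg_left k00 hg.le
      have h2 : X 1 0 * (p.mu1 * (p.lowDecay + p.highDecay)) ≤
          X 1 0 * (p.mu1 * (X 0 0 + X 1 1)) :=
        mul_le_mul_of_nonneg_left
          (mul_le_mul_of_nonneg_left (add_le_add k00 k11) (h0.trans h01).le) x10
      have h3 : X 1 0 * (p.mu1 * p.highDecay) = X 1 0 * p.lam := by rw [hc]
      nlinarith
    simp only [Fin.forall_fin_two, rateMatrix, Matrix.of_apply, Matrix.cons_val',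
      Matrix.cons_val_zero, Matrix.cons_val_one, Matrix.cons_val_fin_one]
    exact ⟨⟨k00, x01⟩, k10, k11⟩

theorem IsMinimalSolution.eq {R R' : Matrix (Fin 2) (Fin 2) ℝ} (h : p.IsMinimalSolution R)
    (h' : p.IsMinimalSolution R') : R = R' := by
  ext i j
  exact le_antisymm (h.2 R' h'.1 i j) (h'.2 R h.1 i j)

theorem norm_lt_one_of_mem_spectrum_rateMatrix (hp : p.Stable) {z : ℂ}
    (hz : z ∈ spectrum ℂ (p.rateMatrix.map Complex.ofReal)) : ‖z‖ < 1 := by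
  rw [spectrum.mem_iff, Matrix.isUnit_iff_isUnit_det, isUnit_iff_ne_zero, not_not,
    Matrix.det_fin_two] at hz
  simp only [rateMatrix, Matrix.algebraMap_eq_diagonal, Matrix.sub_apply, Matrix.map_apply,
    Matrix.of_apply, Matrix.cons_val', Matrix.cons_val_zero, Matrix.cons_val_one,
    Matrix.cons_val_fin_one, Matrix.diagonal_apply_eq, Pi.algebraMap_apply,
    Algebra.algebraMap_self_apply, ne_eq, zero_ne_one, not_false_eq_true,
    Matrix.diagonal_apply_ne, Complex.ofReal_zero, sub_zero, zero_mul] at hz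
  rcases mul_eq_zero.1 hz with h | h
  · rw [sub_eq_zero.1 h, Complex.norm_real, Real.norm_of_nonneg (lowDecay_pos hp).le]
    exact lowDecay_lt_one hp
  · rw [sub_eq_zero.1 h, Complex.norm_real, Real.norm_of_nonneg (highDecay_pos hp).le]
    exact highDecay_lt_one hp

/-! ### The balance equations -/

/-- The balance equations of the chain: those across the cuts between neighbouring numbers of
customers, and those of the states with high mode. -/
structure IsBalanced (p : Params) (π : State → ℝ) : Prop where
  cut : ∀ n, p.lam * (π (0, n) + π (1, n)) = p.mu0 * π (0, n + 1) + p.mu1 * π (1, n + 1)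
  high_zero : p.mu1 * π (1, 1) = (p.lam + p.gam) * π (1, 0)
  high_succ : ∀ n, p.lam * π (1, n) + p.mu1 * π (1, n + 2) +
    (if p.K < n + 1 then p.gam * π (0, n + 1) else 0) =
      (p.lam + p.mu1 + if p.K < n + 1 then 0 else p.gam) * π (1, n + 1)

/-- The net flow into a state. -/
def netFlow (p : Params) (π : State → ℝ) : State → ℝ
  | (i, 0) => p.mu i * π (i, 1) - p.lam * π (i, 0) +
      p.gam * (if i = 0 then π (1, 0) else -π (1, 0))
  | (i, n + 1) => p.lam * π (i, n) + p.mu i * π (i, n + 2) -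
      (p.lam + p.mu i) * π (i, n + 1) +
      p.gam * (if i = p.inspectedMode (n + 1) then π (1 - i, n + 1) else -π (i, n + 1))

/-- Only states on the levels `n - 1`, `n`, `n + 1` can contribute, so the sum is finite. For `n =
0` the truncated `n - 1` is `n` again and the set has two levels. -/
theorem hasSum_generator (π : State → ℝ) (y : State) :
    HasSum (fun x => π x * p.generator x y) (p.netFlow π y) := by
  obtain ⟨i, n⟩ := y
  have key : p.netFlow π (i, n) = ∑ x ∈ Finset.univ ×ˢ ({n - 1, n, n + 1} : Finset ℕ),
      π x * p.generator x (i, n) := by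
    rw [Finset.sum_product, Fin.sum_univ_two]
    cases n with
    | zero =>
      fin_cases i <;> simp [netFlow, generator, generatorPart, rate, next, inspectedMode] <;> ring
    | succ n =>
      have h1 : n ∉ ({n + 1, n + 1 + 1} : Finset ℕ) := by simp; omega
      have h2 : n + 1 ∉ ({n + 1 + 1} : Finset ℕ) := by simp
      have h4 : ¬ (n + 1 + 1 = n) := by omega
      rw [Nat.add_sub_cancel]
      simp only [Finset.sum_insert h1, Finset.sum_insert h2, Finset.sum_singleton]
      by_cases hK : p.K < n + 1 <;>
      fin_cases i <;>
        simp [netFlow, generator, generatorPart, rate, next, inspectedMode, hK, h4] <;> ring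
  rw [key]
  refine hasSum_sum_of_ne_finset_zero fun x hx => ?_
  obtain ⟨j, m⟩ := x
  simp only [Finset.mem_product, Finset.mem_univ, true_and, Finset.mem_insert,
    Finset.mem_singleton, not_or] at hx
  have h1 : ¬ (m + 1 = n) := by omega
  have h2 : ¬ (m - 1 = n) := by omega
  simp [generator, generatorPart, next, Prod.ext_iff, h1, h2, hx.2.1]

/-- Adding the balance equations of both modes over the levels up to `n` telescopes to the cut
equation. Conversely, a low-mode equation is a difference of consecutive cut equations minus the
high-mode one. -/
theorem balance_iff (π : State → ℝ) :
    (∀ y, HasSum (fun x => π x * p.generator x y) 0) ↔ p.IsBalanced π := by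
  have h0 : (∀ y, HasSum (fun x => π x * p.generator x y) 0) ↔ ∀ y, p.netFlow π y = 0 :=
    forall_congr' fun y => ⟨fun h => (hasSum_generator π y).unique h,
      fun h => h ▸ hasSum_generator π y⟩
  rw [h0]
  constructor
  · intro h
    have high : ∀ n, p.lam * π (1, n) + p.mu1 * π (1, n + 2) +
        (if p.K < n + 1 then p.gam * π (0, n + 1) else 0) =
          (p.lam + p.mu1 + if p.K < n + 1 then 0 else p.gam) * π (1, n + 1) := by
      intro n
      have := h (1, n + 1)
      by_cases hK : p.K < n + 1 <;> simp [netFlow, mu, inspectedMode, hK] at this ⊢ <;> linarith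
    have high0 : p.mu1 * π (1, 1) = (p.lam + p.gam) * π (1, 0) := by
      have := h (1, 0)
      simp [netFlow, mu] at this
      linarith
    refine ⟨fun n => ?_, high0, high⟩
    induction n with
    | zero =>
      have := h (0, 0)
      simp [netFlow, mu] at this
      simp only [zero_add]
      linarith
    | succ n ih =>
      have h1 := h (0, n + 1)
      have h2 := high n
      by_cases hK : p.K < n + 1 <;> simp [netFlow, mu, inspectedMode, hK] at h1 h2 ⊢ <;> linarith
  · rintro ⟨cut, high0, high⟩ ⟨i, n⟩
    cases n with
    | zero =>
      have := cut 0
      fin_cases i <;> simp [netFlow, mu] at this ⊢ <;> linarith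
    | succ n =>
      have h1 := cut n
      have h2 := cut (n + 1)
      have h3 := high n
      by_cases hK : p.K < n + 1 <;> fin_cases i <;>
        simp [netFlow, mu, inspectedMode, hK] at h1 h2 h3 ⊢ <;> linarith

theorem IsBalanced.smul {π : State → ℝ} (h : p.IsBalanced π) (r : ℝ) :
    p.IsBalanced fun x => r * π x where
  cut n := by linear_combination r * h.cut n
  high_zero := by linear_combination r * h.high_zero
  high_succ n := by
    have := h.high_succ n
    split_ifs at this ⊢ <;> linear_combination r * this

theorem IsBalanced.sub {π π' : State → ℝ} (h : p.IsBalanced π) (h' : p.IsBalanced π') :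
    p.IsBalanced fun x => π x - π' x where
  cut n := by linear_combination h.cut n - h'.cut n
  high_zero := by linear_combination h.high_zero - h'.high_zero
  high_succ n := by
    have h1 := h.high_succ n
    have h2 := h'.high_succ n
    split_ifs at h1 h2 ⊢ <;> linear_combination h1 - h2

/-! ### Summable solutions of the balance equations -/

/-- The sequence `|v n|` is nondecreasing with limit zero. This is how summability excludes a
growing root. -/
theorem eq_zero_of_tendsto_zero_of_succ_eq_mul {v : ℕ → ℝ} {r : ℝ} (hr : 1 ≤ r)
    (hv : ∀ n, v (n + 1) = r * v n) (h0 : Filter.Tendsto v Filter.atTop (nhds 0)) (n : ℕ) :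
    v n = 0 := by
  have hmono : Monotone fun n => |v n| := monotone_nat_of_le_succ fun n => by
    rw [hv, abs_mul, abs_of_nonneg (zero_le_one.trans hr)]
    exact le_mul_of_one_le_left (abs_nonneg _) hr
  have := hmono.ge_of_tendsto (by simpa using h0.abs) n
  exact abs_nonpos_iff.1 this

theorem tendsto_level {π : State → ℝ} (hs : Summable π) (i : Fin 2) (k : ℕ) :
    Filter.Tendsto (fun n => π (i, k + n)) Filter.atTop (nhds 0) :=
  (hs.comp_injective (i := fun n : ℕ => (i, k + n)) fun a b h => by
    simpa using h).tendsto_atTop_zero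

/-- From level `K` on, the low mode obeys a three-term recurrence with characteristic roots
`lowDecay` and `λ / (μ₀ * lowDecay) > 1`. The defect `π (0, K + n + 1) - lowDecay * π (0, K + n)` is
multiplied by the second root at each step and tends to zero, so it vanishes. -/
theorem IsBalanced.low_tail {π : State → ℝ} (h : p.IsBalanced π) (hp : p.Stable)
    (hs : Summable π) (n : ℕ) : π (0, p.K + n + 1) = p.lowDecay * π (0, p.K + n) := by
  have ha := lowDecay_pos hp
  have ha1 := lowDecay_lt_one hp
  have hq := lowDecay_eq hp
  have h0 := hp.mu0_pos
  have hrec : ∀ n, p.mu0 * π (0, p.K + n + 2) =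
      (p.mu0 + p.lam + p.gam) * π (0, p.K + n + 1) - p.lam * π (0, p.K + n) := by
    intro n
    have h1 := h.cut (p.K + n)
    have h2 := h.cut (p.K + n + 1)
    have h3 := h.high_succ (p.K + n)
    have hK : p.K < p.K + n + 1 := by omega
    simp only [hK, if_true] at h3
    linarith
  have key := eq_zero_of_tendsto_zero_of_succ_eq_mul
    (v := fun n => π (0, p.K + (n + 1)) - p.lowDecay * π (0, p.K + n))
    (r := p.lam / (p.mu0 * p.lowDecay)) ?_ ?_ ?_ n
  · linear_combination key
  · rw [one_le_div (by positivity)]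
    nlinarith [mul_pos hp.gam_pos ha, hp.lam_pos]
  · intro n
    have := hrec n
    rw [div_mul_eq_mul_div, eq_div_iff (by positivity)]
    simp only [← add_assoc] at *
    linear_combination p.lowDecay * this - π (0, p.K + n + 1) * hq
  · have h1 := (tendsto_level hs 0 p.K).comp (Filter.tendsto_add_atTop_nat 1)
    have h2 := (tendsto_level hs 0 p.K).const_mul p.lowDecay
    simpa using h1.sub h2

theorem IsBalanced.high_tail {π : State → ℝ} (h : p.IsBalanced π) (hp : p.Stable)
    (hs : Summable π) (n : ℕ) :
    π (1, p.K + n + 1) = p.mixing * π (0, p.K + n) + p.highDecay * π (1, p.K + n) := by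
  have ha1 := lowDecay_lt_one hp
  have hq := lowDecay_eq hp
  have hm := mixing_eq hp
  have hc := mu1_mul_highDecay hp
  have hcut := h.cut (p.K + n)
  rw [h.low_tail hp hs] at hcut
  have hpos : p.mu1 * (1 - p.lowDecay) ≠ 0 := (mul_pos hp.mu1_pos (sub_pos.2 ha1)).ne'
  apply mul_left_cancel₀ hpos
  linear_combination (-(1 - p.lowDecay)) * hcut + π (0, p.K + n) * (hq - hm) -
    (1 - p.lowDecay) * π (1, p.K + n) * hc

theorem level_add_eq_rateMatrix_pow {π : State → ℝ} (h : p.IsBalanced π) (hp : p.Stable)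
    (hs : Summable π) (n : ℕ) :
    level π (p.K + n) = (p.rateMatrix ^ n).mulVec (level π p.K) := by
  induction n with
  | zero => simp
  | succ n ih =>
    rw [pow_succ', ← Matrix.mulVec_mulVec, ← ih]
    ext i
    fin_cases i
    · simpa [level, rateMatrix, Matrix.mulVec, dotProduct, ← add_assoc] using h.low_tail hp hs n
    · simpa [level, rateMatrix, Matrix.mulVec, dotProduct, ← add_assoc] using h.high_tail hp hs n

/-- No sign is assumed, so this applies to differences of solutions. The high-mode recurrence
propagates the zero up to level `K + 1`; `high_tail` at `K` then forces `π (0, K) = 0` because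
`mixing ≠ 0`; the cut equations carry this down the low mode, and the powers of `rateMatrix` carry
it up. -/
theorem IsBalanced.eq_zero {π : State → ℝ} (h : p.IsBalanced π) (hp : p.Stable)
    (hs : Summable π) (h0 : π (1, 0) = 0) : π = 0 := by
  have hx : ∀ n, (n ≤ p.K → π (1, n) = 0) ∧ (n ≤ p.K → π (1, n + 1) = 0) := by
    intro n
    induction n with
    | zero =>
      have := h.high_zero
      rw [h0, mul_zero] at this
      exact ⟨fun _ => h0, fun _ => (mul_eq_zero.1 this).resolve_left hp.mu1_pos.ne'⟩
    | succ n ih =>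
      refine ⟨fun hn => ih.2 (by omega), fun hn => ?_⟩
      have := h.high_succ n
      rw [if_neg (by omega), if_neg (by omega), ih.1 (by omega), ih.2 (by omega)] at this
      simp only [mul_zero, zero_add, add_zero] at this
      exact (mul_eq_zero.1 this).resolve_left hp.mu1_pos.ne'
  have hyK : π (0, p.K) = 0 := by
    have := h.high_tail hp hs 0
    simp only [add_zero, (hx p.K).1 le_rfl, (hx p.K).2 le_rfl, mul_zero] at this
    exact (mul_eq_zero.1 this.symm).resolve_left (mixing_pos hp).ne'
  have hlow : ∀ j, j ≤ p.K → π (0, p.K - j) = 0 := by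
    intro j
    induction j with
    | zero => simpa using hyK
    | succ j ih =>
      intro hj
      have hcut := h.cut (p.K - (j + 1))
      have e : p.K - (j + 1) + 1 = p.K - j := by omega
      rw [e, ih (by omega), (hx _).1 (by omega), (hx _).1 (by omega)] at hcut
      simp only [mul_zero, add_zero] at hcut
      exact (mul_eq_zero.1 hcut).resolve_left hp.lam_pos.ne'
  have hup : ∀ n, level π (p.K + n) = 0 := by
    intro n
    have : level π p.K = 0 := by
      ext i
      fin_cases i
      · exact hyK
      · exact (hx p.K).1 le_rfl
    rw [level_add_eq_rateMatrix_pow h hp hs, this, Matrix.mulVec_zero]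
  ext ⟨i, n⟩
  rcases le_total n p.K with hn | hn
  · fin_cases i
    · have := hlow (p.K - n) (by omega)
      rwa [Nat.sub_sub_self hn] at this
    · exact (hx n).1 hn
  · have := congrFun (hup (n - p.K)) i
    rwa [Nat.add_sub_cancel' hn] at this

theorem IsStationary.isBalanced {π : State → ℝ} (h : p.IsStationary π) : p.IsBalanced π :=
  (balance_iff π).1 h.balance

/-- The combination `π' (1, 0) • π - π (1, 0) • π'` vanishes at `(1, 0)`, hence everywhere;
comparing totals gives `π (1, 0) = π' (1, 0)`, so the plain difference vanishes as well. -/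
theorem IsStationary.eq {π π' : State → ℝ} (hp : p.Stable) (h : p.IsStationary π)
    (h' : p.IsStationary π') : π = π' := by
  have hs := h.total.summable
  have hs' := h'.total.summable
  have h1 := ((h.isBalanced.smul (π' (1, 0))).sub (h'.isBalanced.smul (π (1, 0)))).eq_zero hp
    ((hs.mul_left _).sub (hs'.mul_left _)) (by ring)
  have h2 := ((h.total.mul_left (π' (1, 0))).sub (h'.total.mul_left (π (1, 0)))).unique
    (by rw [h1]; exact hasSum_zero)
  have h3 := (h.isBalanced.sub h'.isBalanced).eq_zero hp (hs.sub hs') (by linarith)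
  ext x
  exact sub_eq_zero.1 (congrFun h3 x)

/-! ### An explicit stationary distribution -/

/-- The solution of the balance equations of the high mode below the threshold. -/
noncomputable def ascent (p : Params) : ℕ → ℝ
  | 0 => 1
  | 1 => (p.lam + p.gam) / p.mu1
  | n + 2 => ((p.lam + p.mu1 + p.gam) * ascent p (n + 1) - p.lam * ascent p n) / p.mu1

/-- The unnormalized weight of the low mode at the threshold. -/
noncomputable def thresholdWeight (p : Params) : ℝ :=
  (p.ascent (p.K + 1) - p.highDecay * p.ascent p.K) / p.mixing

/-- The unnormalized weights of the low mode, going down from the threshold. -/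
noncomputable def descent (p : Params) : ℕ → ℝ
  | 0 => p.thresholdWeight
  | j + 1 => (p.mu1 * p.ascent (p.K - j) + p.mu0 * descent p j) / p.lam - p.ascent (p.K - (j + 1))

/-- The unnormalized weights of the high mode, going up from the threshold. -/
noncomputable def highTail (p : Params) : ℕ → ℝ
  | 0 => p.ascent p.K
  | h + 1 => p.mixing * (p.lowDecay ^ h * p.thresholdWeight) + p.highDecay * highTail p h

/-- The unnormalized stationary distribution. -/
noncomputable def weight (p : Params) (x : State) : ℝ :=
  if x.1 = 0 then
    if x.2 ≤ p.K then p.descent (p.K - x.2) else p.lowDecay ^ (x.2 - p.K) * p.thresholdWeight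
  else if x.2 ≤ p.K then p.ascent x.2 else p.highTail (x.2 - p.K)

/-- The recurrence says that the flux `μ₁ x (n + 1) - λ x n` grows by `γ x (n + 1)` at each step, so
the two positivity claims feed each other. The flux is also what makes `thresholdWeight` and
`descent` positive. -/
theorem ascent_pos_and_flux_pos (hp : p.Stable) (n : ℕ) :
    0 < p.ascent n ∧ 0 < p.mu1 * p.ascent (n + 1) - p.lam * p.ascent n := by
  have hm := hp.mu1_pos
  induction n with
  | zero =>
    refine ⟨one_pos, ?_⟩
    rw [ascent, ascent, mul_div_cancel₀ _ hm.ne']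
    linarith [hp.gam_pos]
  | succ n ih =>
    have h1 : 0 < p.ascent (n + 1) := by
      have := mul_pos hp.lam_pos ih.1
      exact pos_of_mul_pos_right (by linarith [ih.2] : 0 < p.mu1 * p.ascent (n + 1)) hm.le
    refine ⟨h1, ?_⟩
    rw [ascent, mul_div_cancel₀ _ hm.ne']
    linarith [mul_pos hp.gam_pos h1, ih.2]

theorem ascent_pos (hp : p.Stable) (n : ℕ) : 0 < p.ascent n := (ascent_pos_and_flux_pos hp n).1

theorem thresholdWeight_pos (hp : p.Stable) : 0 < p.thresholdWeight := by
  refine div_pos ?_ (mixing_pos hp)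
  have h := (ascent_pos_and_flux_pos hp p.K).2
  rw [← mu1_mul_highDecay hp] at h
  exact pos_of_mul_pos_right
    (by linarith : 0 < p.mu1 * (p.ascent (p.K + 1) - p.highDecay * p.ascent p.K)) hp.mu1_pos.le

theorem descent_pos (hp : p.Stable) (j : ℕ) (hj : j ≤ p.K) : 0 < p.descent j := by
  induction j with
  | zero => exact thresholdWeight_pos hp
  | succ j ih =>
    have h := (ascent_pos_and_flux_pos hp (p.K - (j + 1))).2
    have e : p.K - (j + 1) + 1 = p.K - j := by omega
    rw [e] at h
    rw [descent, sub_pos, lt_div_iff₀ hp.lam_pos]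
    linarith [mul_pos hp.mu0_pos (ih (by omega))]

theorem highTail_pos (hp : p.Stable) (h : ℕ) : 0 < p.highTail h := by
  induction h with
  | zero => exact ascent_pos hp _
  | succ h ih =>
    exact add_pos (mul_pos (mixing_pos hp)
      (mul_pos (pow_pos (lowDecay_pos hp) _) (thresholdWeight_pos hp)))
      (mul_pos (highDecay_pos hp) ih)

theorem weight_pos (hp : p.Stable) (x : State) : 0 < p.weight x := by
  unfold weight
  split_ifs
  · exact descent_pos hp _ (by omega)
  · exact mul_pos (pow_pos (lowDecay_pos hp) _) (thresholdWeight_pos hp)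
  · exact ascent_pos hp _
  · exact highTail_pos hp _

theorem weight_low_add (h : ℕ) :
    p.weight (0, p.K + h) = p.lowDecay ^ h * p.thresholdWeight := by
  cases h <;> simp [weight, descent]

theorem weight_high_add (h : ℕ) : p.weight (1, p.K + h) = p.highTail h := by
  cases h <;> simp [weight, highTail]

/-- At `n = K + 1` the value comes from `highTail`; `thresholdWeight` is chosen so that it agrees
with `ascent`. -/
theorem weight_high_of_le (hp : p.Stable) {n : ℕ} (hn : n ≤ p.K + 1) :
    p.weight (1, n) = p.ascent n := by
  rcases hn.lt_or_eq with h | rfl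
  · simp [weight, Nat.lt_succ_iff.1 h]
  · rw [weight_high_add, highTail, highTail, thresholdWeight, pow_zero, one_mul,
      mul_div_cancel₀ _ (mixing_pos hp).ne']
    ring

theorem weight_low_of_le {n : ℕ} (hn : n ≤ p.K) : p.weight (0, n) = p.descent (p.K - n) := by
  simp [weight, hn]

theorem mu1_mul_mixing (hp : p.Stable) : p.mu1 * p.mixing = p.lam - p.mu0 * p.lowDecay := by
  apply mul_right_cancel₀ (sub_pos.2 (lowDecay_lt_one hp)).ne'
  linear_combination mixing_eq hp - lowDecay_eq hp

theorem isBalanced_weight (hp : p.Stable) : p.IsBalanced p.weight := by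
  have hb := mu1_mul_mixing hp
  have hc := mu1_mul_highDecay hp
  have hm := mixing_eq hp
  refine ⟨fun n => ?_, ?_, fun n => ?_⟩
  · rcases lt_or_ge n p.K with hn | hn
    · rw [weight_high_of_le hp (by omega : n ≤ p.K + 1),
        weight_high_of_le hp (by omega : n + 1 ≤ p.K + 1), weight_low_of_le hn.le,
        weight_low_of_le (by omega : n + 1 ≤ p.K)]
      obtain ⟨j, hj⟩ : ∃ j, p.K = n + 1 + j := ⟨p.K - (n + 1), by omega⟩
      have e1 : p.K - n = j + 1 := by omega
      have e2 : p.K - (n + 1) = j := by omega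
      have e3 : p.K - j = n + 1 := by omega
      have e4 : p.K - (j + 1) = n := by omega
      rw [e1, e2, descent, e3, e4, sub_add_cancel, mul_div_cancel₀ _ hp.lam_pos.ne', add_comm]
    · obtain ⟨h, rfl⟩ := Nat.exists_eq_add_of_le hn
      rw [add_assoc, weight_high_add, weight_high_add, weight_low_add, weight_low_add, highTail]
      linear_combination (-p.lowDecay ^ h * p.thresholdWeight) * hb - p.highTail h * hc
  · rw [weight_high_of_le hp (by omega), weight_high_of_le hp (by omega), ascent, ascent,
      mul_div_cancel₀ _ hp.mu1_pos.ne', mul_one]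
  · rcases lt_or_ge n p.K with hn | hn
    · rw [weight_high_of_le hp (by omega : n ≤ p.K + 1),
        weight_high_of_le hp (by omega : n + 1 ≤ p.K + 1),
        weight_high_of_le hp (by omega : n + 2 ≤ p.K + 1), ascent,
        mul_div_cancel₀ _ hp.mu1_pos.ne', if_neg (by omega), if_neg (by omega)]
      ring
    · obtain ⟨h, rfl⟩ := Nat.exists_eq_add_of_le hn
      rw [add_assoc p.K h 1, add_assoc p.K h 2, weight_high_add, weight_high_add, weight_high_add,
        weight_low_add, highTail, highTail, if_pos (by omega), if_pos (by omega)]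
      linear_combination (-p.lowDecay ^ h * p.thresholdWeight) * hm +
        p.highDecay * p.highTail h * hc +
        (p.mixing * p.lowDecay ^ h * p.thresholdWeight - p.highTail h) * hc

/-- Summing the inequality bounds `(1 - c)` times the partial sums. It replaces a closed form for
`highTail`, which would degenerate when the two decay rates coincide. -/
theorem summable_of_succ_le_mul_add {u e : ℕ → ℝ} {c : ℝ} (hc : c < 1) (hu : ∀ n, 0 ≤ u n)
    (he : ∀ n, 0 ≤ e n) (hs : Summable e) (h : ∀ n, u (n + 1) ≤ c * u n + e n) :
    Summable u := by
  have key : ∀ N, (1 - c) * ∑ n ∈ Finset.range N, u n + u N ≤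
      u 0 + ∑ n ∈ Finset.range N, e n := by
    intro N
    induction N with
    | zero => simp
    | succ N ih =>
      rw [Finset.sum_range_succ, Finset.sum_range_succ]
      linarith [h N]
  refine summable_of_sum_range_le (c := (u 0 + ∑' n, e n) / (1 - c)) hu fun N => ?_
  rw [le_div_iff₀ (sub_pos.2 hc)]
  linarith [key N, hu N, hs.sum_le_tsum (Finset.range N) fun n _ => he n]

theorem summable_prod_fin_two {π : State → ℝ} (hπ : ∀ x, 0 ≤ π x)
    (h0 : Summable fun n => π (0, n)) (h1 : Summable fun n => π (1, n)) : Summable π :=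
  (summable_prod_of_nonneg hπ).2 ⟨Fin.forall_fin_two.2 ⟨h0, h1⟩, Summable.of_finite⟩

theorem summable_weight (hp : p.Stable) : Summable p.weight := by
  have hgeo : Summable fun h => p.lowDecay ^ h * p.thresholdWeight :=
    (summable_geometric_of_lt_one (lowDecay_pos hp).le (lowDecay_lt_one hp)).mul_right _
  have hgeo_nonneg : ∀ h, 0 ≤ p.lowDecay ^ h * p.thresholdWeight := fun h =>
    mul_nonneg (pow_nonneg (lowDecay_pos hp).le _) (thresholdWeight_pos hp).le
  refine summable_prod_fin_two (fun x => (weight_pos hp x).le) ?_ ?_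
  · rw [← summable_nat_add_iff p.K]
    simpa only [add_comm _ p.K, weight_low_add] using hgeo
  · rw [← summable_nat_add_iff p.K]
    simp only [add_comm _ p.K, weight_high_add]
    refine summable_of_succ_le_mul_add (highDecay_lt_one hp) (fun n => (highTail_pos hp n).le)
      (fun n => mul_nonneg (mixing_pos hp).le (hgeo_nonneg n)) (hgeo.mul_left _) fun n => ?_
    rw [highTail, add_comm]

/-- The stationary distribution. -/
noncomputable def stationary (p : Params) (x : State) : ℝ := (∑' y, p.weight y)⁻¹ * p.weight x

theorem tsum_weight_pos (hp : p.Stable) : 0 < ∑' y, p.weight y :=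
  (summable_weight hp).tsum_pos (fun x => (weight_pos hp x).le) (0, 0) (weight_pos hp _)

theorem stationary_pos (hp : p.Stable) (x : State) : 0 < p.stationary x :=
  mul_pos (inv_pos.2 (tsum_weight_pos hp)) (weight_pos hp x)

theorem isStationary_stationary (hp : p.Stable) : p.IsStationary p.stationary where
  nonneg x := (stationary_pos hp x).le
  total := by
    have := (summable_weight hp).hasSum.mul_left (∑' y, p.weight y)⁻¹
    rwa [inv_mul_cancel₀ (tsum_weight_pos hp).ne'] at this
  balance := (balance_iff _).2 ((isBalanced_weight hp).smul _)

theorem existsUnique_isStationary (hp : p.Stable) : ∃! π : State → ℝ, p.IsStationary π :=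
  ⟨p.stationary, isStationary_stationary hp, fun _ h => h.eq hp (isStationary_stationary hp)⟩

/-- All entries of `π_K` are positive and `R ^ h π_K = π_{K+h}` is summable in `h`, so each entry of
`R ^ h` is dominated by `π (i, K + h) / π (j, K)`. -/
theorem summable_rateMatrix_pow (hp : p.Stable) (i j : Fin 2) :
    Summable fun h : ℕ => (p.rateMatrix ^ h) i j := by
  have hR := (isMinimalSolution_rateMatrix hp).1.1
  have hnonneg : ∀ (h : ℕ) i j, 0 ≤ (p.rateMatrix ^ h) i j := by
    intro h
    induction h with
    | zero =>
      intro i j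
      rw [pow_zero, Matrix.one_apply]
      split_ifs <;> norm_num
    | succ h ih =>
      intro i j
      rw [pow_succ, Matrix.mul_apply]
      exact Finset.sum_nonneg fun k _ => mul_nonneg (ih i k) (hR k j)
  have hpos := stationary_pos hp
  have hst := isStationary_stationary hp
  have hs := hst.total.summable
  have hlevel : Summable fun h : ℕ => p.stationary (i, p.K + h) :=
    hs.comp_injective (i := fun h : ℕ => (i, p.K + h)) fun a b h => by simpa using h
  refine Summable.of_nonneg_of_le (fun h => hnonneg h i j) (fun h => ?_)
    (hlevel.mul_right (p.stationary (j, p.K))⁻¹)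
  rw [← div_eq_mul_inv, le_div_iff₀ (hpos _)]
  have := congrFun (level_add_eq_rateMatrix_pow hst.isBalanced hp hs h) i
  rw [level, Matrix.mulVec, dotProduct] at this
  rw [this]
  exact Finset.single_le_sum (f := fun j => (p.rateMatrix ^ h) i j * level p.stationary p.K j)
    (fun k _ => mul_nonneg (hnonneg h i k) (hpos _).le) (Finset.mem_univ j)

/-! ### Independence of the driving randomness -/

instance : IsProbabilityMeasure noiseLaw := by
  unfold noiseLaw
  infer_instance

theorem noiseLaw_preimage_snd (k : ℕ) {B : Set unitInterval} (hB : MeasurableSet B) :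
    noiseLaw {ω | (ω k).2 ∈ B} = volume B := by
  have h : noiseLaw.map (fun ω : Noise => ω k) =
      (expMeasure 1).prod (volume : Measure unitInterval) := Measure.infinitePi_map_eval _ k
  have h2 : ((expMeasure 1).prod (volume : Measure unitInterval)) (Set.univ ×ˢ B) = volume B := by
    rw [Measure.prod_prod, measure_univ, one_mul]
  rw [← h2, ← h, Measure.map_apply (measurable_pi_apply k) (MeasurableSet.univ.prod hB)]
  congr 1
  ext ω
  simp

theorem iIndepFun_noise : iIndepFun (fun k (ω : Noise) => ω k) noiseLaw :=
  iIndepFun_infinitePi (X := fun _ z => z) fun _ => measurable_id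

/-- A set of noises that is determined by the first `k` pairs is independent of pair `k`. -/
theorem noiseLaw_inter {A : Set Noise} (hA : MeasurableSet A) (k : ℕ)
    (hdep : DependsOn (fun ω => ω ∈ A) (Set.Iio k)) {B : Set unitInterval}
    (hB : MeasurableSet B) :
    noiseLaw (A ∩ {ω | (ω k).2 ∈ B}) = noiseLaw A * volume B := by
  have hind := iIndepFun_noise.indepFun_finset (Finset.range k) {k} (by simp)
    fun i => measurable_pi_apply i
  -- Padding the first `k` pairs with an arbitrary value exhibits `A` as a preimage under the
  -- projection to those pairs.
  let extend : ((i : Finset.range k) → ℝ × unitInterval) → Noise := fun t i =>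
    if h : i ∈ Finset.range k then t ⟨i, h⟩ else (0, 0)
  have hext : Measurable extend := by
    refine measurable_pi_lambda _ fun i => ?_
    by_cases h : i ∈ Finset.range k
    · simpa only [extend, h, dite_true] using measurable_pi_apply (⟨i, h⟩ : Finset.range k)
    · simpa only [extend, h, dite_false] using measurable_const
  have hA' : A = (fun (ω : Noise) (i : Finset.range k) => ω i) ⁻¹' (extend ⁻¹' A) := by
    ext ω
    refine iff_of_eq (hdep fun i hi => ?_)
    simp only [extend, Finset.mem_range, Set.mem_Iio.1 hi, dite_true]
  have hB' : {ω : Noise | (ω k).2 ∈ B} =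
      (fun (ω : Noise) (i : ({k} : Finset ℕ)) => ω i) ⁻¹'
        {t | (t ⟨k, Finset.mem_singleton_self k⟩).2 ∈ B} := rfl
  have hmeas : MeasurableSet {t : ({k} : Finset ℕ) → ℝ × unitInterval |
      (t ⟨k, Finset.mem_singleton_self k⟩).2 ∈ B} :=
    (measurable_snd.comp (measurable_pi_apply _)) hB
  have := hind.measure_inter_preimage_eq_mul _ _ (hext hA) hmeas
  rw [← hA', ← hB', noiseLaw_preimage_snd k hB] at this
  exact this

/-- This is the second Borel–Cantelli lemma. -/
theorem ae_frequently_noise_mem {B : Set unitInterval} (hB : MeasurableSet B)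
    (hpos : volume B ≠ 0) : ∀ᵐ ω ∂noiseLaw, ∃ᶠ k in Filter.atTop, (ω k).2 ∈ B := by
  have hm : ∀ k, MeasurableSet {ω : Noise | (ω k).2 ∈ B} := fun k =>
    (measurable_snd.comp (measurable_pi_apply k)) hB
  have hind : iIndepSet (fun k => {ω : Noise | (ω k).2 ∈ B}) noiseLaw := by
    rw [iIndepSet_iff_meas_biInter hm]
    intro s
    exact iIndepFun_noise.measure_inter_preimage_eq_mul s
      (sets := fun _ => {z | z.2 ∈ B}) fun i _ => measurable_snd hB
  have h1 := measure_limsup_eq_one hm hind (by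
    simp only [noiseLaw_preimage_snd _ hB]
    exact ENNReal.tsum_const_eq_top_of_ne_zero hpos)
  rw [← mem_ae_iff_prob_eq_one (MeasurableSet.measurableSet_limsup hm)] at h1
  filter_upwards [h1] with ω hω
  exact Filter.mem_limsup_iff_frequently_mem.1 hω

theorem volume_mul_lt {c t : ℝ} (hc : 0 ≤ c) (hct : c ≤ t) (ht : 0 < t) :
    volume {u : unitInterval | (u : ℝ) * t < c} = ENNReal.ofReal (c / t) := by
  have h : {u : unitInterval | (u : ℝ) * t < c} =
      Set.Iio ⟨c / t, div_nonneg hc ht.le, (div_le_one ht).2 hct⟩ := by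
    ext u
    rw [Set.mem_Iio, ← Subtype.coe_lt_coe]
    exact (lt_div_iff₀ ht).symm
  rw [h, unitInterval.volume_Iio]

theorem measurableSet_mul_lt (c t : ℝ) : MeasurableSet {u : unitInterval | (u : ℝ) * t < c} :=
  measurableSet_lt (measurable_subtype_coe.mul_const t) measurable_const

instance : MeasurableSpace Event := ⊤

instance : DiscreteMeasurableSpace Event := ⟨fun _ => trivial⟩

/-! ### Rates -/

theorem mu_pos (hp : p.Stable) (i : Fin 2) : 0 < p.mu i := by
  fin_cases i
  · exact hp.mu0_pos
  · exact hp.mu1_pos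

theorem mu0_le_mu (hp : p.Stable) (i : Fin 2) : p.mu0 ≤ p.mu i := by
  fin_cases i
  · exact le_rfl
  · exact hp.mu0_lt_mu1.le

theorem mu_le_mu1 (hp : p.Stable) (i : Fin 2) : p.mu i ≤ p.mu1 := by
  fin_cases i
  · exact hp.mu0_lt_mu1.le
  · exact le_rfl

theorem rate_nonneg (hp : p.Stable) (x : State) (e : Event) : 0 ≤ p.rate x e := by
  cases e
  · exact hp.lam_pos.le
  · simp only [rate]
    split_ifs
    exacts [le_rfl, (mu_pos hp _).le]
  · exact hp.gam_pos.le

theorem lam_add_gam_le_totalRate (hp : p.Stable) (x : State) :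
    p.lam + p.gam ≤ p.totalRate x := by
  have := rate_nonneg hp x .service
  simp only [totalRate, rate] at this ⊢
  linarith

theorem totalRate_pos (hp : p.Stable) (x : State) : 0 < p.totalRate x :=
  (add_pos hp.lam_pos hp.gam_pos).trans_le (lam_add_gam_le_totalRate hp x)

theorem totalRate_le (hp : p.Stable) (x : State) :
    p.totalRate x ≤ p.lam + p.mu1 + p.gam := by
  have := mu_le_mu1 hp x.1
  have := hp.mu1_pos
  simp only [totalRate, rate]
  split_ifs <;> linarith

theorem le_totalRate_of_ne_zero (hp : p.Stable) {x : State} (hx : x.2 ≠ 0) :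
    p.lam + p.gam + p.mu0 ≤ p.totalRate x := by
  have := mu0_le_mu hp x.1
  simp only [totalRate, rate, if_neg hx]
  linarith

theorem setOf_chooseEvent_eq_arrival (p : Params) (x : State) :
    {u | p.chooseEvent x u = .arrival} = {u : unitInterval | (u : ℝ) * p.totalRate x < p.lam} := by
  ext u
  simp only [Set.mem_ofPred_eq, chooseEvent]
  split_ifs with h1 h2 <;> simp [h1]

theorem setOf_chooseEvent_eq_service (hp : p.Stable) (x : State) :
    {u | p.chooseEvent x u = .service} =
      {u : unitInterval | (u : ℝ) * p.totalRate x < p.lam + p.gam}ᶜ := by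
  ext u
  have := hp.gam_pos
  simp only [Set.mem_ofPred_eq, chooseEvent, Set.mem_compl_iff]
  split_ifs with h1 h2 <;> simp only [false_iff, true_iff, not_not] <;> linarith

theorem setOf_chooseEvent_eq_inspection (x : State) :
    {u | p.chooseEvent x u = .inspection} =
      {u : unitInterval | (u : ℝ) * p.totalRate x < p.lam + p.gam} \
        {u : unitInterval | (u : ℝ) * p.totalRate x < p.lam} := by
  ext u
  simp only [Set.mem_ofPred_eq, chooseEvent, Set.mem_sdiff]
  split_ifs with h1 h2
  · simp [h1]
  · simp [h1, h2]
  · simp [h2]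

theorem volume_chooseEvent (hp : p.Stable) (x : State) (e : Event) :
    volume {u | p.chooseEvent x u = e} = ENNReal.ofReal (p.rate x e / p.totalRate x) := by
  have ht := totalRate_pos hp x
  have hle := lam_add_gam_le_totalRate hp x
  have hl := hp.lam_pos
  have hg := hp.gam_pos
  have h1 := volume_mul_lt hl.le (by linarith) ht
  have h2 := volume_mul_lt (by linarith) hle ht
  have hnn : (0 : ℝ) ≤ (p.lam + p.gam) / p.totalRate x := by positivity
  cases e with
  | arrival => rw [setOf_chooseEvent_eq_arrival p, h1, rate]
  | service =>
    rw [setOf_chooseEvent_eq_service hp, prob_compl_eq_one_sub (measurableSet_mul_lt _ _), h2,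
      ← ENNReal.ofReal_one, ← ENNReal.ofReal_sub _ hnn, one_sub_div ht.ne']
    congr 2
    simp only [totalRate, rate]
    ring
  | inspection =>
    rw [setOf_chooseEvent_eq_inspection, measure_sdiff _ (measurableSet_mul_lt _ _).nullMeasurableSet
      (measure_ne_top _ _), h1, h2, ← ENNReal.ofReal_sub _ (by positivity), ← sub_div, rate,
      add_sub_cancel_left]
    exact fun u (hu : (u : ℝ) * p.totalRate x < p.lam) => hu.trans (by linarith)

/-! ### Measurability -/

theorem measurable_chooseEvent (p : Params) (x : State) : Measurable (p.chooseEvent x) :=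
  Measurable.ite (measurableSet_mul_lt _ _) measurable_const
    (Measurable.ite (measurableSet_mul_lt _ _) measurable_const measurable_const)

theorem measurable_path (p : Params) (x : TaggedState) (k : ℕ) :
    Measurable fun ω => p.path x ω k := by
  induction k with
  | zero => exact measurable_const
  | succ k ih =>
    have hstep : Measurable fun z : TaggedState × unitInterval =>
        p.taggedNext z.1 (p.chooseEvent (forget z.1) z.2) :=
      measurable_from_prod_countable_right fun t =>
        (Measurable.of_discrete (f := p.taggedNext t)).comp
          (p.measurable_chooseEvent (forget t))
    exact hstep.comp (ih.prodMk (measurable_snd.comp (measurable_pi_apply k)))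

theorem measurable_forget_path (p : Params) (x : TaggedState) (k : ℕ) :
    Measurable fun ω => forget (p.path x ω k) :=
  (Measurable.of_discrete (f := forget)).comp (p.measurable_path x k)

theorem measurable_eventAt (p : Params) (x : TaggedState) (k : ℕ) :
    Measurable fun ω => p.eventAt x ω k := by
  have hstep : Measurable fun z : State × unitInterval => p.chooseEvent z.1 z.2 :=
    measurable_from_prod_countable_right fun t => p.measurable_chooseEvent t
  exact hstep.comp ((p.measurable_forget_path x k).prodMk
    (measurable_snd.comp (measurable_pi_apply k)))

theorem measurable_holdingTime (p : Params) (x : TaggedState) (k : ℕ) :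
    Measurable fun ω => p.holdingTime x ω k :=
  (measurable_fst.comp (measurable_pi_apply k)).div
    ((Measurable.of_discrete (f := p.totalRate)).comp (p.measurable_forget_path x k))

theorem measurable_sojourn (p : Params) (x : TaggedState) : Measurable (p.sojourn x) := by
  refine Measurable.tsum fun k => Measurable.ite ?_ measurable_const
    (p.measurable_holdingTime x k).ennreal_ofReal
  exact p.measurable_path x k (MeasurableSet.of_discrete (s := {t : TaggedState | t.2.1 = 0}))

theorem measurable_stationarySojourn (p : Params) : Measurable p.stationarySojourn :=
  measurable_from_prod_countable_right fun x => p.measurable_sojourn (enter x)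

theorem measurable_firstArrival (p : Params) (x : TaggedState) :
    Measurable (p.firstArrival x) := by
  have hm : ∀ k, MeasurableSet {ω | p.eventAt x ω k = .arrival} := fun k =>
    p.measurable_eventAt x k (MeasurableSet.of_discrete (s := {Event.arrival}))
  refine measurable_to_countable' fun k => ?_
  -- The second piece collects the noises without any arrival, for which `sInf ∅ = 0`.
  have : p.firstArrival x ⁻¹' {k} =
      ({ω | p.eventAt x ω k = .arrival} ∩ ⋂ j, ⋂ _ : j < k, {ω | p.eventAt x ω j = .arrival}ᶜ) ∪
        ((⋂ j, {ω | p.eventAt x ω j = .arrival}ᶜ) ∩ {_ω | k = 0}) := by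
    ext ω
    simp only [Set.mem_preimage, Set.mem_singleton_iff, Set.mem_union, Set.mem_inter_iff,
      Set.mem_ofPred_eq, Set.mem_iInter, Set.mem_compl_iff, firstArrival]
    constructor
    · rintro rfl
      rcases Set.eq_empty_or_nonempty {k | p.eventAt x ω k = .arrival} with h | h
      · right
        exact ⟨fun j hj => by simpa [h] using (show j ∈ {k | p.eventAt x ω k = .arrival} from hj),
          by simp [h]⟩
      · exact Or.inl ⟨Nat.sInf_mem h, fun j hj => Nat.notMem_of_lt_sInf hj⟩
    · rintro (⟨h1, h2⟩ | ⟨h1, rfl⟩)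
      · refine le_antisymm (Nat.sInf_le h1) (le_csInf ⟨k, h1⟩ fun j hj => ?_)
        by_contra! hlt
        exact h2 j hlt hj
      · simp [h1]
  rw [this]
  exact ((hm k).inter (MeasurableSet.iInter fun j =>
    MeasurableSet.iInter fun _ => (hm j).compl)).union
    ((MeasurableSet.iInter fun j => (hm j).compl).inter (MeasurableSet.const _))

theorem measurable_foundByNext (p : Params) (x : TaggedState) :
    Measurable (p.foundByNext x) := by
  have h : Measurable fun z : ℕ × Noise => forget (p.path x z.2 z.1) :=
    measurable_from_prod_countable_right fun k => p.measurable_forget_path x k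
  exact h.comp ((p.measurable_firstArrival x).prodMk measurable_id)

theorem measurable_foundByNext_enter (p : Params) :
    Measurable fun z : State × Noise => p.foundByNext (enter z.1) z.2 :=
  measurable_from_prod_countable_right fun x => p.measurable_foundByNext (enter x)

theorem dependsOn_path (p : Params) (x : TaggedState) (k : ℕ) :
    DependsOn (fun ω => p.path x ω k) (Set.Iio k) := by
  intro ω ω' h
  induction k with
  | zero => rfl
  | succ k ih =>
    have hk : p.path x ω k = p.path x ω' k := ih fun i hi => h i (Nat.lt_succ_of_lt hi)
    simp only [path, hk, h k (Set.mem_Iio.2 (Nat.lt_succ_self k))]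

theorem dependsOn_eventAt (p : Params) (x : TaggedState) (k : ℕ) :
    DependsOn (fun ω => p.eventAt x ω k) (Set.Iio (k + 1)) := by
  intro ω ω' h
  have hk : p.path x ω k = p.path x ω' k :=
    p.dependsOn_path x k fun i hi => h i (Nat.lt_succ_of_lt hi)
  simp only [eventAt, hk, h k (Set.mem_Iio.2 (Nat.lt_succ_self k))]

/-! ### Finiteness of sojourn times -/

theorem path_position_succ_le (p : Params) (x : TaggedState) (ω : Noise) (k : ℕ) :
    (p.path x ω (k + 1)).2.1 ≤ (p.path x ω k).2.1 := by
  rw [path]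
  cases p.chooseEvent (forget (p.path x ω k)) (ω k).2
  · exact le_rfl
  · simp only [taggedNext]
    split_ifs <;> simp
  · exact le_rfl

theorem antitone_path_position (p : Params) (x : TaggedState) (ω : Noise) :
    Antitone fun k => (p.path x ω k).2.1 :=
  antitone_nat_of_succ_le (p.path_position_succ_le x ω)

theorem sojourn_lt_top_of_position_eq_zero (x : TaggedState) (ω : Noise) {k : ℕ}
    (hk : (p.path x ω k).2.1 = 0) : p.sojourn x ω < ∞ := by
  rw [sojourn, tsum_eq_sum (s := Finset.range k)]
  · refine ENNReal.sum_lt_top.2 fun j _ => ?_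
    split_ifs
    exacts [ENNReal.zero_lt_top, ENNReal.ofReal_lt_top]
  · intro j hj
    rw [Finset.mem_range, not_lt] at hj
    have := p.antitone_path_position x ω hj
    rw [if_pos (by simp only at this; omega)]

/-- While the tagged customer is present the total rate is at least `λ + γ + μ₀`, so a number `u` in
this fixed set selects a service whatever the state. Each such service moves the customer one
position forward. -/
theorem exists_position_eq_zero (hp : p.Stable) (x : TaggedState) (ω : Noise)
    (hω : ∃ᶠ k in Filter.atTop, (ω k).2 ∈
      {u : unitInterval | (u : ℝ) * (p.lam + p.gam + p.mu0) < p.lam + p.gam}ᶜ) :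
    ∃ k, (p.path x ω k).2.1 = 0 := by
  have key : ∀ v k, (p.path x ω k).2.1 ≤ v → ∃ k, (p.path x ω k).2.1 = 0 := by
    intro v
    induction v with
    | zero => exact fun k hk => ⟨k, Nat.le_zero.1 hk⟩
    | succ v ih =>
      intro k hk
      obtain ⟨j, hj, hmem⟩ := Filter.frequently_atTop.1 hω k
      rcases Nat.eq_zero_or_pos (p.path x ω j).2.1 with h0 | hpos
      · exact ⟨j, h0⟩
      · have hle : (p.path x ω j).2.1 ≤ v + 1 := (p.antitone_path_position x ω hj).trans hk
        refine ih (j + 1) ?_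
        have hserv : p.chooseEvent (forget (p.path x ω j)) (ω j).2 = .service := by
          have : (ω j).2 ∈ {u | p.chooseEvent (forget (p.path x ω j)) u = .service} := by
            rw [setOf_chooseEvent_eq_service hp]
            simp only [Set.mem_compl_iff, Set.mem_ofPred_eq, not_lt] at hmem ⊢
            refine hmem.trans (mul_le_mul_of_nonneg_left ?_ (ω j).2.2.1)
            exact le_totalRate_of_ne_zero hp (by simp only [forget]; omega)
          exact this
        rw [path, hserv, taggedNext, if_neg hpos.ne']
        simp only
        omega
  exact key _ 0 le_rfl

theorem ae_sojourn_lt_top (hp : p.Stable) (x : TaggedState) :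
    ∀ᵐ ω ∂noiseLaw, p.sojourn x ω < ∞ := by
  have hl := hp.lam_pos
  have hg := hp.gam_pos
  have h0 := hp.mu0_pos
  have hvol : volume {u : unitInterval | (u : ℝ) * (p.lam + p.gam + p.mu0) < p.lam + p.gam}ᶜ ≠
      0 := by
    rw [prob_compl_eq_one_sub (measurableSet_mul_lt _ _),
      volume_mul_lt (by positivity) (by linarith) (by positivity), Ne, tsub_eq_zero_iff_le, not_le,
      ← ENNReal.ofReal_one, ENNReal.ofReal_lt_ofReal_iff one_pos, div_lt_one (by positivity)]
    linarith
  filter_upwards [ae_frequently_noise_mem (measurableSet_mul_lt _ _).compl hvol] with ω hω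
  obtain ⟨k, hk⟩ := exists_position_eq_zero hp x ω hω
  exact sojourn_lt_top_of_position_eq_zero x ω hk

/-- The total rate never exceeds `λ + μ₁ + γ`, so numbers below `λ / (λ + μ₁ + γ)` select an arrival
in every state. -/
theorem ae_exists_arrival (hp : p.Stable) (x : TaggedState) :
    ∀ᵐ ω ∂noiseLaw, ∃ k, p.eventAt x ω k = .arrival := by
  have hl := hp.lam_pos
  have hg := hp.gam_pos
  have h1 := hp.mu1_pos
  have hvol : volume {u : unitInterval | (u : ℝ) * (p.lam + p.mu1 + p.gam) < p.lam} ≠ 0 := by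
    rw [volume_mul_lt hl.le (by linarith) (by positivity), Ne, ENNReal.ofReal_eq_zero, not_le]
    positivity
  filter_upwards [ae_frequently_noise_mem (measurableSet_mul_lt _ _) hvol] with ω hω
  obtain ⟨k, hk⟩ := hω.exists
  refine ⟨k, ?_⟩
  have : (ω k).2 ∈ {u | p.chooseEvent (forget (p.path x ω k)) u = .arrival} := by
    rw [setOf_chooseEvent_eq_arrival p]
    exact lt_of_le_of_lt (mul_le_mul_of_nonneg_left (totalRate_le hp _) (ω k).2.2.1) hk
  exact this

/-! ### The queue between two arrivals -/

theorem forget_taggedNext (p : Params) (t : TaggedState) (e : Event) :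
    forget (p.taggedNext t e) = p.next (forget t) e := by
  obtain ⟨i, n, m⟩ := t
  cases e
  · simp [forget, taggedNext, next, add_assoc]
  · simp only [forget, taggedNext, next]
    split_ifs with h
    · simp [h]
    · simp only [Prod.mk.injEq, true_and]
      omega
  · rfl

theorem forget_path_succ (p : Params) (x : TaggedState) (ω : Noise) (k : ℕ) :
    forget (p.path x ω (k + 1)) =
      p.next (forget (p.path x ω k)) (p.chooseEvent (forget (p.path x ω k)) (ω k).2) :=
  p.forget_taggedNext _ _

/-- No arrival is among the first `k` events, and the queue is in state `y` after them. -/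
def quietAt (p : Params) (x : TaggedState) (k : ℕ) (y : State) : Set Noise :=
  {ω | forget (p.path x ω k) = y ∧ ∀ j < k, p.eventAt x ω j ≠ .arrival}

theorem measurableSet_quietAt (p : Params) (x : TaggedState) (k : ℕ) (y : State) :
    MeasurableSet (p.quietAt x k y) := by
  have : p.quietAt x k y = (fun ω => forget (p.path x ω k)) ⁻¹' {y} ∩
      ⋂ j, ⋂ _ : j < k, (fun ω => p.eventAt x ω j) ⁻¹' {Event.arrival}ᶜ := by
    ext ω
    simp [quietAt]
  rw [this]
  exact (p.measurable_forget_path x k (MeasurableSet.singleton y)).inter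
    (MeasurableSet.iInter fun j => MeasurableSet.iInter fun _ =>
      p.measurable_eventAt x j MeasurableSet.of_discrete)

theorem dependsOn_quietAt (p : Params) (x : TaggedState) (k : ℕ) (y : State) :
    DependsOn (fun ω => ω ∈ p.quietAt x k y) (Set.Iio k) := by
  intro ω ω' h
  have h1 : p.path x ω k = p.path x ω' k := p.dependsOn_path x k h
  have h2 : ∀ j < k, p.eventAt x ω j = p.eventAt x ω' j := fun j hj =>
    p.dependsOn_eventAt x j fun i hi =>
      h i (lt_of_lt_of_le (Set.mem_Iio.1 hi) hj)
  simp only [quietAt, Set.mem_ofPred_eq, h1, eq_iff_iff]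
  exact and_congr_right fun _ => forall₂_congr fun j hj => by rw [h2 j hj]

/-- The probability that no arrival is among the first `k` events and that the queue is in
state `y` after them. -/
noncomputable def quietProb (p : Params) (x : TaggedState) (k : ℕ) (y : State) : ℝ≥0∞ :=
  noiseLaw (p.quietAt x k y)

/-- The probability that the next event is not an arrival and leads from `z` to `y`. -/
noncomputable def quietStep (p : Params) (z y : State) : ℝ≥0∞ :=
  volume {u | p.chooseEvent z u ≠ .arrival ∧ p.next z (p.chooseEvent z u) = y}

theorem quietProb_zero (p : Params) (x : TaggedState) (y : State) :
    p.quietProb x 0 y = if forget x = y then 1 else 0 := by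
  unfold quietProb quietAt
  split_ifs with h <;> simp [path, h]

/-- The Markov property: `quietAt x k z` depends on the first `k` pairs only, and pair `k` decides
the next event. -/
theorem quietProb_succ (p : Params) (x : TaggedState) (k : ℕ) (y : State) :
    p.quietProb x (k + 1) y = ∑' z, p.quietProb x k z * p.quietStep z y := by
  have hB : ∀ z, MeasurableSet
      {u | p.chooseEvent z u ≠ .arrival ∧ p.next z (p.chooseEvent z u) = y} := fun z =>
    p.measurable_chooseEvent z
      (MeasurableSet.of_discrete (s := {e : Event | e ≠ Event.arrival ∧ p.next z e = y}))
  have hset : p.quietAt x (k + 1) y = ⋃ z, p.quietAt x k z ∩ {ω | (ω k).2 ∈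
      {u | p.chooseEvent z u ≠ .arrival ∧ p.next z (p.chooseEvent z u) = y}} := by
    ext ω
    simp only [quietAt, Set.mem_ofPred_eq, Set.mem_iUnion, Set.mem_inter_iff, forget_path_succ,
      Nat.forall_lt_succ_right, eventAt]
    constructor
    · rintro ⟨h1, h2, h3⟩
      exact ⟨_, ⟨rfl, h2⟩, h3, h1⟩
    · rintro ⟨z, ⟨rfl, h2⟩, h3, h1⟩
      exact ⟨h1, h2, h3⟩
  rw [quietProb, hset, measure_iUnion]
  · exact tsum_congr fun z =>
      noiseLaw_inter (p.measurableSet_quietAt x k z) k (p.dependsOn_quietAt x k z) (hB z)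
  · intro z z' hz
    refine Set.disjoint_left.2 fun ω h h' => hz ?_
    exact h.1.1.symm.trans h'.1.1
  · exact fun z => (p.measurableSet_quietAt x k z).inter
      ((measurable_snd.comp (measurable_pi_apply k)) (hB z))

/-- Split by the number `k` of the first arrival: the queue is quiet up to `k`, and an independent
choice in state `y` is an arrival. -/
theorem noiseLaw_foundByNext (hp : p.Stable) (x : TaggedState) (y : State) :
    noiseLaw {ω | p.foundByNext x ω = y} =
      (∑' k, p.quietProb x k y) * ENNReal.ofReal (p.lam / p.totalRate y) := by
  have hB : MeasurableSet {u | p.chooseEvent y u = .arrival} :=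
    p.measurable_chooseEvent y (MeasurableSet.of_discrete (s := {Event.arrival}))
  have hset : {ω | p.foundByNext x ω = y} =ᵐ[noiseLaw]
      ⋃ k, p.quietAt x k y ∩ {ω | (ω k).2 ∈ {u | p.chooseEvent y u = .arrival}} := by
    filter_upwards [ae_exists_arrival hp x] with ω hω
    apply propext
    change p.foundByNext x ω = y ↔ ω ∈ ⋃ k, _
    simp only [Set.mem_iUnion, Set.mem_inter_iff, quietAt, Set.mem_ofPred_eq]
    constructor
    · rintro rfl
      refine ⟨p.firstArrival x ω, ⟨rfl, fun j hj => Nat.notMem_of_lt_sInf hj⟩, ?_⟩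
      exact Nat.sInf_mem (s := {k | p.eventAt x ω k = .arrival}) hω
    · rintro ⟨k, ⟨rfl, h2⟩, h3⟩
      have : p.firstArrival x ω = k := by
        refine le_antisymm (Nat.sInf_le h3) (le_csInf ⟨k, h3⟩ fun j hj => ?_)
        by_contra! hlt
        exact h2 j hlt hj
      rw [foundByNext, this]
  have hvol := volume_chooseEvent hp y .arrival
  rw [rate] at hvol
  rw [measure_congr hset, measure_iUnion, ← ENNReal.tsum_mul_right]
  · refine tsum_congr fun k => ?_
    rw [noiseLaw_inter (p.measurableSet_quietAt x k y) k (p.dependsOn_quietAt x k y) hB, hvol,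
      quietProb]
  · intro j k hjk
    refine Set.disjoint_left.2 fun ω h h' => ?_
    have e1 : p.eventAt x ω j = .arrival := by
      have := h.2
      rw [← h.1.1] at this
      exact this
    have e2 : p.eventAt x ω k = .arrival := by
      have := h'.2
      rw [← h'.1.1] at this
      exact this
    rcases lt_or_gt_of_ne hjk with hlt | hlt
    · exact h'.1.2 j hlt e1
    · exact h.1.2 k hlt e2
  · exact fun k => (p.measurableSet_quietAt x k y).inter
      ((measurable_snd.comp (measurable_pi_apply k)) hB)

/-- The rate at which the events lead from `z` to `y`. -/
noncomputable def inflow (p : Params) (z y : State) : ℝ :=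
  p.rate z .arrival * (if p.next z .arrival = y then 1 else 0) +
    p.rate z .service * (if p.next z .service = y then 1 else 0) +
    p.rate z .inspection * (if p.next z .inspection = y then 1 else 0)

theorem inflow_nonneg (hp : p.Stable) (z y : State) : 0 ≤ p.inflow z y := by
  have h := rate_nonneg hp z
  unfold inflow
  have h1 := h .arrival
  have h2 := h .service
  have h3 := h .inspection
  split_ifs <;> simp <;> positivity

theorem generator_eq (p : Params) (z y : State) :
    p.generator z y = p.inflow z y - if z = y then p.totalRate z else 0 := by
  unfold generator generatorPart inflow totalRate
  split_ifs <;> ring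

theorem quietStep_eq (hp : p.Stable) (z y : State) :
    p.quietStep z y = ENNReal.ofReal
      (p.rate z .service / p.totalRate z * (if p.next z .service = y then 1 else 0) +
        p.rate z .inspection / p.totalRate z *
          (if p.next z .inspection = y then 1 else 0)) := by
  have ht := (totalRate_pos hp z).le
  have part : ∀ e, volume {u | p.chooseEvent z u = e ∧ p.next z e = y} =
      ENNReal.ofReal (p.rate z e / p.totalRate z * (if p.next z e = y then 1 else 0)) := by
    intro e
    split_ifs with h
    · simp only [h, and_true, mul_one, volume_chooseEvent hp]
    · simp [h]
  have hset : {u | p.chooseEvent z u ≠ .arrival ∧ p.next z (p.chooseEvent z u) = y} =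
      {u | p.chooseEvent z u = .service ∧ p.next z .service = y} ∪
        {u | p.chooseEvent z u = .inspection ∧ p.next z .inspection = y} := by
    ext u
    simp only [Set.mem_ofPred_eq, Set.mem_union]
    cases p.chooseEvent z u <;> simp
  rw [quietStep, hset, measure_union, part, part, ENNReal.ofReal_add]
  · exact mul_nonneg (div_nonneg (rate_nonneg hp _ _) ht) (by split_ifs <;> norm_num)
  · exact mul_nonneg (div_nonneg (rate_nonneg hp _ _) ht) (by split_ifs <;> norm_num)
  · refine Set.disjoint_left.2 fun u h h' => ?_
    have := h.1.symm.trans h'.1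
    simp at this
  · exact p.measurable_chooseEvent z
      (MeasurableSet.of_discrete (s := {e | e = .inspection ∧ p.next z .inspection = y}))

theorem arrival_add_quietStep (hp : p.Stable) (z y : State) :
    (if p.next z .arrival = y then 1 else 0) +
      ENNReal.ofReal (p.totalRate z / p.lam) * p.quietStep z y =
        ENNReal.ofReal (p.inflow z y / p.lam) := by
  have ht := totalRate_pos hp z
  have hl := hp.lam_pos
  have h2 := rate_nonneg hp z .service
  have h3 := rate_nonneg hp z .inspection
  have h1 : (if p.next z .arrival = y then 1 else 0 : ℝ≥0∞) =
      ENNReal.ofReal (if p.next z .arrival = y then 1 else 0) := by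
    split_ifs <;> simp
  rw [quietStep_eq hp, h1, ← ENNReal.ofReal_mul (by positivity), ← ENNReal.ofReal_add]
  · congr 1
    unfold inflow
    rw [rate]
    field_simp
    ring
  · split_ifs <;> norm_num
  · refine mul_nonneg (by positivity) (add_nonneg ?_ ?_) <;>
      exact mul_nonneg (by positivity) (by split_ifs <;> norm_num)

/-- Started from weights `a` on the states found by a customer: the weight of the trajectories
with no arrival among the next `k` events and with the queue in state `y` after them. -/
noncomputable def quietWeight (p : Params) (a : State → ℝ≥0∞) (k : ℕ) (y : State) : ℝ≥0∞ :=
  ∑' x, a x * p.quietProb (enter x) k y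

theorem quietWeight_zero (p : Params) (a : State → ℝ≥0∞) (y : State) :
    p.quietWeight a 0 y = ∑' z, a z * if p.next z .arrival = y then 1 else 0 :=
  tsum_congr fun z => by rw [quietProb_zero]; rfl

theorem quietWeight_succ (p : Params) (a : State → ℝ≥0∞) (k : ℕ) (y : State) :
    p.quietWeight a (k + 1) y = ∑' z, p.quietWeight a k z * p.quietStep z y := by
  simp only [quietWeight, quietProb_succ, ← ENNReal.tsum_mul_left, ← ENNReal.tsum_mul_right,
    mul_assoc]
  exact ENNReal.tsum_comm

theorem map_foundByNext_singleton (hp : p.Stable) (α : Measure State) [IsProbabilityMeasure α]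
    (y : State) :
    (α.prod noiseLaw).map (fun z : State × Noise => p.foundByNext (enter z.1) z.2) {y} =
      (∑' k, p.quietWeight (fun x => α {x}) k y) * ENNReal.ofReal (p.lam / p.totalRate y) := by
  have hm := p.measurable_foundByNext_enter (MeasurableSet.singleton y)
  rw [Measure.map_apply p.measurable_foundByNext_enter (MeasurableSet.singleton y),
    Measure.prod_apply hm, lintegral_countable', ← ENNReal.tsum_mul_right]
  have h : ∀ x : State, noiseLaw (Prod.mk x ⁻¹'
      ((fun z : State × Noise => p.foundByNext (enter z.1) z.2) ⁻¹' {y})) * α {x} =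
      ∑' k, α {x} * p.quietProb (enter x) k y * ENNReal.ofReal (p.lam / p.totalRate y) := by
    intro x
    have := noiseLaw_foundByNext hp (enter x) y
    rw [mul_comm, ENNReal.tsum_mul_right, ENNReal.tsum_mul_left, mul_assoc, ← this]
    rfl
  simp only [h, quietWeight, ← ENNReal.tsum_mul_right]
  exact ENNReal.tsum_comm

/-! ### Stationarity at arrivals and global balance -/

/-- The balance equations, for weights with values in `ℝ≥0∞` and in units of the arrival rate. -/
def IsFlowBalanced (p : Params) (a : State → ℝ≥0∞) : Prop :=
  ∀ y, a y * ENNReal.ofReal (p.totalRate y / p.lam) =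
    ∑' z, a z * ENNReal.ofReal (p.inflow z y / p.lam)

/-- With `b z = a z * totalRate z / λ`, flow balance becomes the first-step equation `b =
quietWeight a 0 + b * quietStep`; iterating it produces the series `∑ k, quietWeight a k`. -/
theorem tsum_inflow_eq (hp : p.Stable) (a : State → ℝ≥0∞) (y : State) :
    ∑' z, a z * ENNReal.ofReal (p.inflow z y / p.lam) =
      p.quietWeight a 0 y +
        ∑' z, a z * ENNReal.ofReal (p.totalRate z / p.lam) * p.quietStep z y := by
  rw [quietWeight_zero, ← ENNReal.tsum_add]
  exact tsum_congr fun z => by rw [← arrival_add_quietStep hp, mul_add, mul_assoc]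

theorem ofReal_totalRate_mul_cancel (hp : p.Stable) (y : State) :
    ENNReal.ofReal (p.lam / p.totalRate y) * ENNReal.ofReal (p.totalRate y / p.lam) = 1 := by
  have ht := totalRate_pos hp y
  have hl := hp.lam_pos
  rw [← ENNReal.ofReal_mul (by positivity), div_mul_div_cancel₀ ht.ne', div_self hl.ne',
    ENNReal.ofReal_one]

theorem IsArrivalStationary.isFlowBalanced (hp : p.Stable) {α : Measure State}
    (h : p.IsArrivalStationary α) : p.IsFlowBalanced fun x => α {x} := by
  have := h.isProbabilityMeasure
  have key : ∀ y, α {y} * ENNReal.ofReal (p.totalRate y / p.lam) =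
      ∑' k, p.quietWeight (fun x => α {x}) k y := by
    intro y
    conv_lhs => rw [← h.invariant]
    rw [map_foundByNext_singleton hp, mul_assoc, ofReal_totalRate_mul_cancel hp, mul_one]
  intro y
  rw [tsum_inflow_eq hp, key, tsum_eq_zero_add' ENNReal.summable]
  congr 1
  simp only [key, quietWeight_succ, ← ENNReal.tsum_mul_right]
  exact ENNReal.tsum_comm

/-- Minimality of the series among nonnegative solutions of the first-step equation: its partial
sums stay below any solution, by induction. -/
theorem IsFlowBalanced.tsum_quietWeight_le (hp : p.Stable) {a : State → ℝ≥0∞}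
    (h : p.IsFlowBalanced a) (y : State) :
    ∑' k, p.quietWeight a k y ≤ a y * ENNReal.ofReal (p.totalRate y / p.lam) := by
  refine ENNReal.tsum_le_of_sum_range_le fun N => ?_
  induction N generalizing y with
  | zero => simp
  | succ N ih =>
    rw [Finset.sum_range_succ', h y, tsum_inflow_eq hp, add_comm]
    gcongr
    simp only [quietWeight_succ]
    rw [← Summable.tsum_finsetSum fun _ _ => ENNReal.summable]
    refine ENNReal.tsum_le_tsum fun z => ?_
    rw [← Finset.sum_mul]
    gcongr
    exact ih z

/-- Minimality gives only an inequality between the law found by the next customer and `α`, but both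
are probability measures, so they are equal. -/
theorem isArrivalStationary_of_isFlowBalanced (hp : p.Stable) {α : Measure State}
    [IsProbabilityMeasure α] (h : p.IsFlowBalanced fun x => α {x}) : p.IsArrivalStationary α := by
  refine ⟨inferInstance, ?_⟩
  have hprob := Measure.isProbabilityMeasure_map (μ := α.prod noiseLaw)
    p.measurable_foundByNext_enter.aemeasurable
  refine Measure.eq_of_le_of_isProbabilityMeasure (Measure.le_iff.2 fun s hs => ?_)
  rw [← Measure.tsum_indicator_apply_singleton _ s hs,
    ← Measure.tsum_indicator_apply_singleton α s hs]
  refine ENNReal.tsum_le_tsum fun y => Set.indicator_le_indicator ?_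
  rw [map_foundByNext_singleton hp]
  calc _ ≤ α {y} * ENNReal.ofReal (p.totalRate y / p.lam) *
        ENNReal.ofReal (p.lam / p.totalRate y) := by
        gcongr
        exact h.tsum_quietWeight_le hp y
    _ = α {y} := by
        rw [mul_assoc, mul_comm (ENNReal.ofReal _), ofReal_totalRate_mul_cancel hp, mul_one]

/-- Multiply by `λ` and move the diagonal term across. In `ℝ≥0∞` the finite left side makes the
inflows summable. -/
theorem isFlowBalanced_iff (hp : p.Stable) {π : State → ℝ} (hπ : ∀ x, 0 ≤ π x) :
    p.IsFlowBalanced (fun x => ENNReal.ofReal (π x)) ↔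
      ∀ y, HasSum (fun x => π x * p.generator x y) 0 := by
  have hl := hp.lam_pos
  refine forall_congr' fun y => ?_
  have hsingle : HasSum (fun z => if z = y then π y * p.totalRate y else 0)
      (π y * p.totalRate y) := hasSum_ite_eq _ _
  have hgen : ∀ z, π z * p.generator z y = p.lam * (π z * (p.inflow z y / p.lam)) -
      if z = y then π y * p.totalRate y else 0 := by
    intro z
    rw [generator_eq]
    split_ifs with hz
    · subst hz
      field_simp
    · field_simp
      ring
  have hnn : ∀ z, 0 ≤ π z * (p.inflow z y / p.lam) := fun z =>
    mul_nonneg (hπ z) (div_nonneg (inflow_nonneg hp z y) hl.le)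
  have hty := mul_nonneg (hπ y) (div_nonneg (totalRate_pos hp y).le hl.le)
  simp only [← ENNReal.ofReal_mul (hπ _)]
  constructor
  · intro h
    have hne : ∑' z, ENNReal.ofReal (π z * (p.inflow z y / p.lam)) ≠ ∞ :=
      h ▸ ENNReal.ofReal_ne_top
    have h1 := ENNReal.hasSum_toReal hne
    rw [← ENNReal.tsum_toReal_eq fun _ => ENNReal.ofReal_ne_top, ← h] at h1
    simp only [ENNReal.toReal_ofReal (hnn _), ENNReal.toReal_ofReal hty] at h1
    have h2 := (h1.mul_left p.lam).sub hsingle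
    have h0 : p.lam * (π y * (p.totalRate y / p.lam)) - π y * p.totalRate y = 0 := by
      rw [mul_left_comm, mul_div_cancel₀ _ hl.ne', sub_self]
    rw [h0] at h2
    rwa [funext hgen]
  · intro h
    have h1 := (h.add hsingle).mul_left p.lam⁻¹
    simp only [hgen, sub_add_cancel, inv_mul_cancel_left₀ hl.ne', zero_add] at h1
    rw [← ENNReal.ofReal_tsum_of_nonneg hnn h1.summable, h1.tsum_eq]
    congr 1
    field_simp

theorem IsArrivalStationary.isStationary (hp : p.Stable) {α : Measure State}
    (h : p.IsArrivalStationary α) : p.IsStationary fun x => α.real {x} := by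
  have := h.isProbabilityMeasure
  have htotal : ∑' x, α {x} = 1 := by
    have := Measure.tsum_indicator_apply_singleton α Set.univ MeasurableSet.univ
    simpa using this
  refine ⟨fun x => measureReal_nonneg, ?_, ?_⟩
  · have := ENNReal.hasSum_toReal (f := fun x => α {x}) (by simp [htotal])
    rwa [← ENNReal.tsum_toReal_eq fun _ => measure_ne_top _ _, htotal, ENNReal.toReal_one] at this
  · rw [← isFlowBalanced_iff hp fun x => measureReal_nonneg]
    have hreal : ∀ x, ENNReal.ofReal (α.real {x}) = α {x} := fun x => ofReal_measureReal
    simpa only [hreal] using h.isFlowBalanced hp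

theorem IsStationary.exists_isArrivalStationary (hp : p.Stable) {π : State → ℝ}
    (h : p.IsStationary π) : ∃ α : Measure State, p.IsArrivalStationary α := by
  let α : Measure State := Measure.sum fun x => ENNReal.ofReal (π x) • Measure.dirac x
  have hα : ∀ x, α {x} = ENNReal.ofReal (π x) := fun x => Measure.sum_smul_dirac_singleton
  have hprob : IsProbabilityMeasure α := by
    constructor
    have := Measure.tsum_indicator_apply_singleton α Set.univ MeasurableSet.univ
    simp only [Set.indicator_univ, hα] at this
    rw [← this, ← ENNReal.ofReal_tsum_of_nonneg h.nonneg h.total.summable, h.total.tsum_eq,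
      ENNReal.ofReal_one]
  refine ⟨α, isArrivalStationary_of_isFlowBalanced hp ?_⟩
  simp only [hα]
  exact (isFlowBalanced_iff hp h.nonneg).2 h.balance

theorem existsUnique_isArrivalStationary (hp : p.Stable) :
    ∃! α : Measure State, p.IsArrivalStationary α := by
  obtain ⟨α, hα⟩ := (isStationary_stationary hp).exists_isArrivalStationary hp
  refine ⟨α, hα, fun β hβ => ?_⟩
  have := hα.isProbabilityMeasure
  have := hβ.isProbabilityMeasure
  refine Measure.ext_of_singleton fun x => ?_
  have := congrFun ((hβ.isStationary hp).eq hp (hα.isStationary hp)) x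
  exact (measureReal_eq_measureReal_iff).1 this

/-! ### Laplace transforms -/

theorem norm_exp_neg_mul_toReal_le_one {s : ℂ} (hs : 0 ≤ s.re) (t : ℝ≥0∞) :
    ‖Complex.exp (-s * (t.toReal : ℂ))‖ ≤ 1 := by
  rw [Complex.norm_exp, Real.exp_le_one_iff]
  simpa using mul_nonneg hs ENNReal.toReal_nonneg

theorem integrable_exp_neg_mul_toReal {Ω : Type*} [MeasurableSpace Ω] {P : Measure Ω}
    [IsProbabilityMeasure P] {T : Ω → ℝ≥0∞} (hT : Measurable T) {s : ℂ} (hs : 0 ≤ s.re) :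
    Integrable (fun ω => Complex.exp (-s * ((T ω).toReal : ℂ))) P := by
  refine (integrable_const (1 : ℝ)).mono' ?_
    (Filter.Eventually.of_forall fun ω => norm_exp_neg_mul_toReal_le_one hs _)
  exact (Complex.measurable_exp.comp
    ((Complex.measurable_ofReal.comp hT.ennreal_toReal).const_mul _)).aestronglyMeasurable

theorem norm_psi_le_one (p : Params) (n m : ℕ) {s : ℂ} (hs : 0 ≤ s.re) (i : Fin 2) :
    ‖p.psi n m s i‖ ≤ 1 := by
  have := norm_integral_le_of_norm_le_const (μ := noiseLaw)
    (Filter.Eventually.of_forall fun ω =>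
      norm_exp_neg_mul_toReal_le_one hs (p.sojourn (i, n, m) ω))
  simpa [psi, laplace] using this

/-- Fubini gives a sum over the states found, absolutely convergent because `|ψ| ≤ 1`; it is then
grouped by the number of customers. -/
theorem hasSum_laplace_stationarySojourn (p : Params) {α : Measure State}
    [IsProbabilityMeasure α] {s : ℂ} (hs : 0 ≤ s.re) :
    HasSum (fun n => p.psi (n + 1) 0 s ⬝ᵥ toComplex (level (fun x => α.real {x}) n))
      (laplace (α.prod noiseLaw) p.stationarySojourn s) := by
  have hint := integrable_exp_neg_mul_toReal (P := α.prod noiseLaw)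
    p.measurable_stationarySojourn hs
  have h1 : laplace (α.prod noiseLaw) p.stationarySojourn s =
      ∑' x : State, α.real {x} • p.psi (x.2 + 1) 0 s x.1 := by
    rw [laplace, integral_prod _ hint, integral_countable hint.integral_prod_left]
    rfl
  have htotal : Summable fun x : State => α.real {x} := by
    refine ENNReal.summable_toReal (f := fun x => α {x}) ?_
    have := Measure.tsum_indicator_apply_singleton α Set.univ MeasurableSet.univ
    rw [Set.indicator_univ, measure_univ] at this
    simp [this]
  have hsum : Summable fun x : State => α.real {x} • p.psi (x.2 + 1) 0 s x.1 := by
    refine Summable.of_norm_bounded htotal fun x => ?_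
    rw [norm_smul, Real.norm_of_nonneg measureReal_nonneg]
    exact mul_le_of_le_one_right measureReal_nonneg (p.norm_psi_le_one _ _ hs _)
  have h2 := (Equiv.prodComm ℕ (Fin 2)).hasSum_iff.2 hsum.hasSum
  rw [← h1] at h2
  convert h2.prod_fiberwise fun n => hasSum_fintype _ using 2 with n
  refine Finset.sum_congr rfl fun i _ => ?_
  simp [toComplex, level, mul_comm]

theorem toComplex_mulVec_pow (R : Matrix (Fin 2) (Fin 2) ℝ) (h : ℕ) (v : Fin 2 → ℝ) :
    toComplex ((R ^ h).mulVec v) = ((R.map Complex.ofReal) ^ h).mulVec (toComplex v) := by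
  have hpow : (R.map Complex.ofReal) ^ h = (R ^ h).map Complex.ofReal :=
    (map_pow Complex.ofRealHom.mapMatrix R h).symm
  ext i
  rw [hpow]
  exact RingHom.map_mulVec Complex.ofRealHom (R ^ h) v i

theorem phiTerm_dotProduct (R : Matrix (Fin 2) (Fin 2) ℝ) (m : ℕ) (s : ℂ) (h : ℕ)
    (v : Fin 2 → ℝ) :
    p.phiTerm (R.map Complex.ofReal) m s h ⬝ᵥ toComplex v =
      p.psi (p.K + h + 1) m s ⬝ᵥ toComplex ((R ^ h).mulVec v) := by
  rw [toComplex_mulVec_pow, phiTerm, Matrix.dotProduct_mulVec]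

theorem summable_phiTerm_rateMatrix (hp : p.Stable) (m : ℕ) {s : ℂ} (hs : 0 ≤ s.re) :
    Summable (p.phiTerm (p.rateMatrix.map Complex.ofReal) m s) := by
  refine Pi.summable.2 fun j => ?_
  have hpow : ∀ h : ℕ, (p.rateMatrix.map Complex.ofReal) ^ h =
      (p.rateMatrix ^ h).map Complex.ofReal := fun h =>
    (map_pow Complex.ofRealHom.mapMatrix p.rateMatrix h).symm
  simp only [phiTerm, hpow, Matrix.vecMul, dotProduct, Matrix.map_apply]
  refine summable_sum fun i _ => ?_
  refine Summable.of_norm_bounded (summable_rateMatrix_pow hp i j).norm fun h => ?_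
  rw [norm_mul, Complex.norm_real]
  exact mul_le_of_le_one_left (norm_nonneg _) (p.norm_psi_le_one _ _ hs _)

end Params

end InspectionQueue

open InspectionQueue InspectionQueue.Params in
theorem proposition2 (p : Params) (hK : 0 < p.K) (hlam : 0 < p.lam) (hmu0 : 0 < p.mu0)
    (hmu : p.mu0 < p.mu1) (hgam : 0 < p.gam) (hstable : p.lam < p.mu1) :
    (∃! π : State → ℝ, p.IsStationary π) ∧
    (∃! R : Matrix (Fin 2) (Fin 2) ℝ, p.IsMinimalSolution R) ∧
    (∃! α : Measure State, p.IsArrivalStationary α) ∧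
    (∀ i n m, ∀ᵐ ω ∂noiseLaw, p.sojourn (i, n, m) ω < ∞) ∧
    ∀ (π : State → ℝ) (R : Matrix (Fin 2) (Fin 2) ℝ) (α : Measure State),
      p.IsStationary π → p.IsMinimalSolution R → p.IsArrivalStationary α →
      (∀ h : ℕ, level π (p.K + h) = (R ^ h).mulVec (level π p.K)) ∧
      (∀ z ∈ spectrum ℂ (R.map Complex.ofReal), ‖z‖ < 1) ∧
      (∀ᵐ z ∂(α.prod noiseLaw), p.stationarySojourn z < ∞) ∧
      ∀ s : ℂ, 0 ≤ s.re →
        Summable (p.phiTerm (R.map Complex.ofReal) 0 s) ∧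
        laplace (α.prod noiseLaw) p.stationarySojourn s =
          ∑ n ∈ Finset.range p.K, p.psi (n + 1) 0 s ⬝ᵥ toComplex (level π n) +
            p.phi (R.map Complex.ofReal) 0 s ⬝ᵥ toComplex (level π p.K) := by
  have hp : p.Stable := ⟨hlam, hmu0, hmu, hgam, hstable⟩
  refine ⟨existsUnique_isStationary hp, ⟨p.rateMatrix, isMinimalSolution_rateMatrix hp,
    fun R hR => hR.eq (isMinimalSolution_rateMatrix hp)⟩, existsUnique_isArrivalStationary hp,
    fun i n m => ae_sojourn_lt_top hp (i, n, m), ?_⟩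
  intro π R α hπ hR hα
  obtain rfl := hR.eq (isMinimalSolution_rateMatrix hp)
  have hprob := hα.isProbabilityMeasure
  have hlevel := level_add_eq_rateMatrix_pow hπ.isBalanced hp hπ.total.summable
  refine ⟨hlevel, fun z hz => norm_lt_one_of_mem_spectrum_rateMatrix hp hz, ?_, fun s hs => ?_⟩
  · refine Measure.ae_prod_iff_ae_ae ?_ |>.2 (Filter.Eventually.of_forall fun x =>
      ae_sojourn_lt_top hp (enter x))
    exact measurableSet_lt p.measurable_stationarySojourn measurable_const
  · have hsum := summable_phiTerm_rateMatrix hp 0 hs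
    refine ⟨hsum, ?_⟩
    have h1 := hasSum_laplace_stationarySojourn p (α := α) hs
    -- Arrivals see the stationary distribution: the point masses of `α` are `π`.
    rw [(hα.isStationary hp).eq hp hπ] at h1
    rw [← h1.tsum_eq, ← h1.summable.sum_add_tsum_nat_add p.K]
    congr 1
    have h2 : HasSum (fun h => p.phiTerm (p.rateMatrix.map Complex.ofReal) 0 s h ⬝ᵥ
        toComplex (level π p.K))
        (p.phi (p.rateMatrix.map Complex.ofReal) 0 s ⬝ᵥ toComplex (level π p.K)) :=
      hasSum_sum fun i _ => (Pi.hasSum.1 hsum.hasSum i).mul_right _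
    rw [← h2.tsum_eq]
    refine tsum_congr fun h => ?_
    rw [phiTerm_dotProduct, ← hlevel, add_comm h]
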